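/- Let $d \ge 2$, let $\widehat f(\xi)=\int_{\mathbb R^d} f(x)e^{-ix\cdot\xi}\,dx$ (extended to $L^2(\mathbb R^d)$ as usual), let $(-\Delta)^s$ be the Fourier multiplier in the space variable with symbol $|\xi|^{2s}$, and let $\|f\|_{\dot H^1}=\|(-\Delta)^{1/2}f\|_{L^2(\mathbb R^d)}$. For every $u_0\in H^1(\mathbb R^d)$ and every solution $u\in C(\mathbb R;L^2(\mathbb R^d))$ of the free Schrödinger equation $i\partial_t u+\Delta u=0$, $u(0)=u_0$ (in the sense of distributions), $$\|(-\Delta)^{\frac{4-d}{4}}(|u|^2)\|_{L^2(\mathbb R\times\mathbb R^d)}^2\le \frac{2^{-d}\pi^{\frac{2-d}{2}}}{\Gamma(\frac{d+2}{2})}\,\|u_0\|_{\dot H^1(\mathbb R^d)}^2\,\|u_0\|_{L^2(\mathbb R^d)}^2 ,$$ and the constant is optimal: the estimate fails for some $u_0\in H^1(\mathbb R^d)$ if the constant is replaced by any smaller one. Furthermore, a function $u_0 \in L^2(\mathbb R^d)$ is an extremiser (that is, $u_0$ is a nonzero element of $H^1(\mathbb R^d)$ for whose solution $u$ equality holds)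 if and only if $\widehat u_0$ is a gaussian with radial modulus, i.e. there are $a,c\in\mathbb C$ with $\operatorname{Re}a<0$ and $b\in\mathbb R^d$ such that $$\widehat u_0(\eta)=\exp(a|\eta|^2+i\,b\cdot\eta+c)\quad\text{for almost every }\eta\in\mathbb R^d .$$ -/

import Mathlib

open MeasureTheory FourierTransform
open scoped SchwartzMap ENNReal Laplacian

noncomputable section

namespace OzawaTsutsumi

/-- Euclidean space `ℝ^d`. -/
abbrev Space (d : ℕ) : Type := EuclideanSpace ℝ (Fin d)

/-- The complex Hilbert space `L²(ℝ^d)`. -/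
abbrev L2 (d : ℕ) : Type := Lp ℂ 2 (volume : Measure (Space d))

/-- `u ∈ C(ℝ; L²(ℝ^d))` solves `i ∂ₜ u + Δ u = 0`, `u(0) = u₀`: the time derivative exists in the
sense of tempered distributions on `ℝ^d` and equals `i Δ u(t)` at every time `t`, where `Δ` is
the distributional Laplacian. -/
structure IsSchrodingerSolution {d : ℕ} (u₀ : L2 d) (u : ℝ → L2 d) : Prop where
  continuous : Continuous u
  initial : u 0 = u₀
  equation : ∀ (φ : 𝓢(Space d, ℂ)) (t : ℝ),
    HasDerivAt (fun s : ℝ => (u s : 𝓢'(Space d, ℂ)) φ)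
      (Complex.I * (Δ (u t : 𝓢'(Space d, ℂ))) φ) t

/-- The symbol of `(-Δ)^s` applied to `F`. Mathlib's Fourier transform has the kernel
`exp(-2πi x·ξ)`, so that the symbol of `(-Δ)^s` is `|2πξ|^{2s}`. -/
def applySymbol {d : ℕ} (s : ℝ) (F : Space d → ℂ) (ξ : Space d) : ℂ :=
  (((2 * Real.pi * ‖ξ‖) ^ (2 * s) : ℝ) : ℂ) * F ξ

open Classical in
/-- `‖(-Δ)^s f‖_{L²(ℝ^d)}` for `f` with Fourier transform `F` (a function): if `|2πξ|^{2s} F` is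
square integrable then `(-Δ)^s f` is its inverse Fourier transform in `L²`; otherwise
`(-Δ)^s f` is not in `L²`, and the norm is `∞`. -/
def fracLaplacianNorm {d : ℕ} (s : ℝ) (F : Space d → ℂ) : ℝ≥0∞ :=
  if h : MemLp (applySymbol s F) 2 volume then ‖(𝓕⁻ (h.toLp (applySymbol s F)) : L2 d)‖ₑ else ∞

/-- `‖u₀‖_{Ḣ^s} = ‖(-Δ)^{s/2} u₀‖_{L²}` for `u₀ ∈ L²(ℝ^d)`, by the `L²` Fourier transform. -/
def homSobolevNorm {d : ℕ} (s : ℝ) (u₀ : L2 d) : ℝ≥0∞ :=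
  fracLaplacianNorm (s / 2) (𝓕 u₀ : L2 d)

/-- The integrable function `|v|²` on `ℝ^d`, for `v ∈ L²(ℝ^d)`. -/
def modSq {d : ℕ} (v : L2 d) (x : Space d) : ℂ := ((‖v x‖ ^ 2 : ℝ) : ℂ)

/-- `‖(-Δ)^s (|u|²)‖²_{L²(ℝ × ℝ^d)}`, where `(-Δ)^s` acts in the space variable; the Fourier
transform of the integrable function `|u(t)|²` is the Fourier integral. -/
def spaceTimeNormSq {d : ℕ} (s : ℝ) (u : ℝ → L2 d) : ℝ≥0∞ :=
  ∫⁻ t : ℝ, (fracLaplacianNorm s (𝓕 (modSq (u t)))) ^ 2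

/-- `u₀` lies in the inhomogeneous Sobolev space `H¹(ℝ^d)`. -/
def MemH1 {d : ℕ} (u₀ : L2 d) : Prop :=
  TemperedDistribution.MemSobolev 1 2 (u₀ : 𝓢'(Space d, ℂ))

/-- The Fourier transform `û₀(ξ) = ∫ u₀(x) exp(-i x·ξ) dx` on `L²(ℝ^d)`, in terms of Mathlib's,
which has the kernel `exp(-2πi x·ξ)`. -/
def angularFourier {d : ℕ} (u₀ : L2 d) (ξ : Space d) : ℂ :=
  (𝓕 u₀ : L2 d) ((2 * Real.pi)⁻¹ • ξ)

/-- Gaussian functions with radial modulus: `exp(a|η|² + i b·η + c)` with `a, c ∈ ℂ`, `Re a < 0`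
and `b ∈ ℝ^d`. -/
def IsRadialModulusGaussian {d : ℕ} (g : Space d → ℂ) : Prop :=
  ∃ (a c : ℂ) (b : Space d), a.re < 0 ∧
    g = fun η => Complex.exp (a * (‖η‖ ^ 2 : ℝ) + Complex.I * (inner ℝ b η : ℝ) + c)

/-- The estimate `‖(-Δ)^{(4-d)/4}(|u|²)‖²_{L²} ≤ C ‖u₀‖²_{Ḣ¹} ‖u₀‖²_{L²}` for all solutions `u`
with initial data `u₀ ∈ H¹`. -/
def EstimateHolds (d : ℕ) (C : ℝ) : Prop :=
  ∀ (u₀ : L2 d) (u : ℝ → L2 d), MemH1 u₀ → IsSchrodingerSolution u₀ u →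
    spaceTimeNormSq ((4 - d : ℝ) / 4) u
      ≤ ENNReal.ofReal C * homSobolevNorm 1 u₀ ^ 2 * ‖u₀‖ₑ ^ 2

/-- `u₀` is an extremiser for the estimate with constant `C`: a nonzero element of `H¹` whose
solution attains equality. -/
def IsExtremiser {d : ℕ} (C : ℝ) (u₀ : L2 d) : Prop :=
  u₀ ≠ 0 ∧ MemH1 u₀ ∧ ∃ u : ℝ → L2 d, IsSchrodingerSolution u₀ u ∧
    spaceTimeNormSq ((4 - d : ℝ) / 4) u
      = ENNReal.ofReal C * homSobolevNorm 1 u₀ ^ 2 * ‖u₀‖ₑ ^ 2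

/-- The constant `2^{-d} π^{(2-d)/2} / Γ((d+2)/2)`. -/
def sharpConstant (d : ℕ) : ℝ :=
  (2 : ℝ) ^ (-(d : ℝ)) * Real.pi ^ ((2 - d : ℝ) / 2) / Real.Gamma ((d + 2 : ℝ) / 2)

end OzawaTsutsumi

end

noncomputable section

namespace OzawaTsutsumi

open Filter Topology Complex

local notation "conj" => starRingEnd ℂ

variable {d : ℕ}

/-! The proof makes the deficit in the inequality explicit. Write `F` for the Fourier transform of
`u₀`. The transform of `|u(t)|²` at `ξ` is, up to a unimodular factor, the autocorrelation of `F` at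
shift `ξ` with the phase `exp(-8π² i t η·ξ)` (`spaceTimeNormSq_eq`). In polar coordinates `ξ = ρω`
this phase depends on `η` only through `r = η·ω`, so the time integral is a one-dimensional
Plancherel identity for `H(r) = ∫ F(r,y) conj F(r-ρ,y) dy`, with `y` orthogonal to `ω`. The exponent
`(4-d)/4` is the one that leaves the weight `ρ²` (`spaceTimeIntegral_eq_polar`).

Cauchy–Schwarz in `y`, in the form of Lagrange's identity, bounds `|H(r)|²` with an exact remainder.
The remainder compares `F(a)F(b)` with the product after `a` and `b` exchange their `ω`-components,
that is, after an elastic collision (`collision_identity`). Averaging the main term over `ω` turns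
`((a-b)·ω)₊²` into a multiple of `|a-b|²` (`halfMoment_eq`), and expanding the square gives the
product of the two norms minus the square of the first moment of `|F|²`. Hence norm + collision
defect + first moment defect = right-hand side (`spaceTimeIntegral_add_defects`).

Equality therefore means that both defects vanish. If the collision defect vanishes, `F ⊗ F` is
collision invariant almost everywhere. A Gaussian factor preserves this and makes `F` integrable;
the Fourier transform preserves it again and gives a continuous function, which solves the
functional equation pointwise. For `d ≥ 2` its solutions are exponentials of `κ|x|²` plus an affine
function (`IsCollisionInvariant.exists_exp`). Transforming back, `F` is a Gaussian, and the
vanishing first moment makes its linear coefficient purely imaginary. Since such Gaussians attain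
equality with a finite nonzero right-hand side, the constant is optimal. -/

lemma eLpNorm_two_sq {α F : Type*} [MeasurableSpace α] [NormedAddCommGroup F] {μ : Measure α}
    (f : α → F) : eLpNorm f 2 μ ^ 2 = ∫⁻ x, ‖f x‖ₑ ^ 2 ∂μ := by
  simpa using eLpNorm_nnreal_pow_eq_lintegral (f := f) (μ := μ) (p := 2) (by norm_num)

/-- The class of a Schwartz function in `L²`. -/
@[irreducible] def toL2 (ψ : 𝓢(Space d, ℂ)) : L2 d := ψ.toLp 2

lemma coeFn_toL2 (ψ : 𝓢(Space d, ℂ)) : toL2 ψ =ᵐ[volume] ψ := by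
  unfold toL2
  exact ψ.coeFn_toLp 2 volume

lemma enorm_L2_sq (g : L2 d) : ‖g‖ₑ ^ 2 = ∫⁻ x, ‖g x‖ₑ ^ 2 := by
  rw [Lp.enorm_def, eLpNorm_two_sq]

lemma lintegral_L2_lt_top (g : L2 d) : ∫⁻ x, ‖g x‖ₑ ^ 2 < ∞ := by
  rw [← enorm_L2_sq]; exact ENNReal.pow_lt_top enorm_lt_top

/-! ### The free propagator as a multiplication operator on `L²` -/

/-- The Fourier symbol `exp(-4π² i t |x|²)` of the free Schrödinger propagator. -/
def phase (t : ℝ) (x : Space d) : ℂ := cexp (I * ((-(4 * Real.pi ^ 2) * ‖x‖ ^ 2 * t : ℝ) : ℂ))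

@[simp] lemma norm_phase (t : ℝ) (x : Space d) : ‖phase t x‖ = 1 := by
  rw [phase, mul_comm, Complex.norm_exp_ofReal_mul_I]

lemma continuous_phase (t : ℝ) : Continuous (phase (d := d) t) := by
  unfold phase; fun_prop

lemma phase_add (s t : ℝ) (x : Space d) : phase (s + t) x = phase s x * phase t x := by
  rw [phase, phase, phase, ← Complex.exp_add]; congr 1; push_cast; ring

@[simp] lemma phase_zero (x : Space d) : phase 0 x = 1 := by simp [phase]

lemma norm_exp_I_mul_sub_one_sub_le (x : ℝ) : ‖cexp (I * x) - 1 - I * x‖ ≤ 3 * x ^ 2 := by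
  by_cases h : |x| ≤ 1
  · have := Complex.norm_exp_sub_one_sub_id_le (x := I * x) (by simpa using h)
    refine this.trans ?_
    simp only [norm_mul, norm_I, one_mul, norm_real, Real.norm_eq_abs, sq_abs]
    nlinarith [sq_nonneg x]
  · push Not at h
    calc ‖cexp (I * x) - 1 - I * x‖ ≤ ‖cexp (I * x) - 1‖ + ‖I * (x : ℂ)‖ := norm_sub_le _ _
      _ ≤ |x| + |x| := by
        gcongr
        · simpa using Real.norm_exp_I_mul_ofReal_sub_one_le (x := x)
        · simp
      _ ≤ 3 * x ^ 2 := by rw [← sq_abs x]; nlinarith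

lemma memLp_phase_mul (t : ℝ) (g : L2 d) : MemLp (fun x => phase t x * g x) 2 volume :=
  (Lp.memLp g).congr_norm
    ((continuous_phase t).aestronglyMeasurable.mul (Lp.aestronglyMeasurable g))
    (ae_of_all _ fun x => by simp)

/-- Multiplication by the symbol of the propagator on `L²`. -/
@[irreducible] def phaseMul (t : ℝ) (g : L2 d) : L2 d := (memLp_phase_mul t g).toLp _

lemma coeFn_phaseMul (t : ℝ) (g : L2 d) : phaseMul t g =ᵐ[volume] fun x => phase t x * g x := by
  unfold phaseMul
  exact MemLp.coeFn_toLp _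

lemma phaseMul_zero (g : L2 d) : phaseMul 0 g = g := by
  apply Lp.ext
  filter_upwards [coeFn_phaseMul 0 g] with x hx
  simp [hx]

/-- With `|x|⁴ g` in `L²`, the pointwise second-order Taylor remainder of the phase is bounded in
norm by a multiple of `(s-t)²`, so the derivative exists in `L²` and not only weakly. -/
lemma hasDerivAt_phaseMul {g g₁ g₂ : L2 d} (h₁ : g₁ =ᵐ[volume] fun x => (‖x‖ ^ 2 : ℝ) * g x)
    (h₂ : g₂ =ᵐ[volume] fun x => (‖x‖ ^ 2 : ℝ) * g₁ x) (t : ℝ) :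
    HasDerivAt (fun s => phaseMul s g) ((-(4 * Real.pi ^ 2) * I : ℂ) • phaseMul t g₁) t := by
  rw [hasDerivAt_iff_isLittleO]
  have hbound : ∀ s : ℝ, ‖phaseMul s g - phaseMul t g -
      (s - t) • ((-(4 * Real.pi ^ 2) * I : ℂ) • phaseMul t g₁)‖ ≤
      (3 * (4 * Real.pi ^ 2) ^ 2 * (s - t) ^ 2) * ‖g₂‖ := by
    intro s
    apply Lp.norm_le_mul_norm_of_ae_le_mul
    filter_upwards [h₁, h₂, coeFn_phaseMul t g, coeFn_phaseMul s g, coeFn_phaseMul t g₁,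
      Lp.coeFn_sub (phaseMul s g - phaseMul t g)
        ((s - t) • ((-(4 * Real.pi ^ 2) * I : ℂ) • phaseMul t g₁)),
      Lp.coeFn_sub (phaseMul s g) (phaseMul t g),
      Lp.coeFn_smul (s - t) ((-(4 * Real.pi ^ 2) * I : ℂ) • phaseMul t g₁),
      Lp.coeFn_smul (-(4 * Real.pi ^ 2) * I : ℂ) (phaseMul t g₁)]
      with x e1 e2 e3 e4 e5 e6 e7 e8 e9
    rw [e6, Pi.sub_apply, e7, Pi.sub_apply, e8, Pi.smul_apply, e9, Pi.smul_apply, e3, e4, e5, e2,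
      e1]
    have hs : phase s x = phase (s - t) x * phase t x := by rw [← phase_add]; simp
    have key := norm_exp_I_mul_sub_one_sub_le (-(4 * Real.pi ^ 2) * ‖x‖ ^ 2 * (s - t))
    rw [show phase s x * g x - phase t x * g x - (s - t) • ((-(4 * Real.pi ^ 2) * I : ℂ) •
      (phase t x * (((‖x‖ ^ 2 : ℝ) : ℂ) * g x))) = (phase t x * g x) *
      (cexp (I * ((-(4 * Real.pi ^ 2) * ‖x‖ ^ 2 * (s - t) : ℝ) : ℂ)) - 1 -
        I * ((-(4 * Real.pi ^ 2) * ‖x‖ ^ 2 * (s - t) : ℝ) : ℂ)) by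
      rw [hs, phase, Complex.real_smul, smul_eq_mul]; push_cast; ring]
    rw [norm_mul, norm_mul, norm_phase, one_mul]
    calc ‖g x‖ * _ ≤ ‖g x‖ * (3 * (-(4 * Real.pi ^ 2) * ‖x‖ ^ 2 * (s - t)) ^ 2) := by gcongr
      _ = _ := by
        simp only [norm_mul, norm_real, norm_pow, norm_norm]; ring
  have hO : (fun s => phaseMul s g - phaseMul t g -
      (s - t) • ((-(4 * Real.pi ^ 2) * I : ℂ) • phaseMul t g₁)) =O[𝓝 t]
      fun s => (s - t) ^ 2 := by
    apply Asymptotics.IsBigO.of_bound (3 * (4 * Real.pi ^ 2) ^ 2 * ‖g₂‖)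
    refine Eventually.of_forall fun s => (hbound s).trans (le_of_eq ?_)
    rw [Real.norm_eq_abs, abs_of_nonneg (sq_nonneg _)]; ring
  refine hO.trans_isLittleO ?_
  have h1 : (fun s : ℝ => (s - t) ^ 2) = fun s => (s - t) * (s - t) := by ext; ring
  rw [h1]
  have h2 : (fun s : ℝ => s - t) =o[𝓝 t] (fun _ => (1 : ℝ)) := by
    rw [Asymptotics.isLittleO_one_iff]
    have : Tendsto (fun s : ℝ => s - t) (𝓝 t) (𝓝 (t - t)) := by
      exact (continuous_id.sub continuous_const).tendsto t
    simpa using this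
  simpa using h2.mul_isBigO (Asymptotics.isBigO_refl (fun s : ℝ => s - t) (𝓝 t))

lemma continuous_phaseMul (g : L2 d) : Continuous fun t => phaseMul t g := by
  rw [continuous_iff_continuousAt]
  intro t
  have hsq : ∀ s, ‖phaseMul s g - phaseMul t g‖ₑ ^ 2
      = ∫⁻ x, ‖phase s x * g x - phase t x * g x‖ₑ ^ 2 := by
    intro s
    rw [enorm_L2_sq]
    apply lintegral_congr_ae
    filter_upwards [coeFn_phaseMul t g, coeFn_phaseMul s g,
      Lp.coeFn_sub (phaseMul s g) (phaseMul t g)] with x h1 h2 h3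
    rw [h3, Pi.sub_apply, h1, h2]
  have hlim : Tendsto (fun s => ∫⁻ x, ‖phase s x * g x - phase t x * g x‖ₑ ^ 2) (𝓝 t)
      (𝓝 (∫⁻ _ : Space d, 0)) := by
    refine tendsto_lintegral_filter_of_dominated_convergence (fun x => 4 * ‖g x‖ₑ ^ 2) ?_ ?_ ?_ ?_
    · have := (Lp.stronglyMeasurable g).measurable
      exact Eventually.of_forall fun s =>
        ((((continuous_phase s).measurable.mul this).sub
          ((continuous_phase t).measurable.mul this)).enorm.pow_const 2)
    · refine Eventually.of_forall fun s => ae_of_all _ fun x => ?_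
      have : ‖phase s x * g x - phase t x * g x‖ₑ ≤ 2 * ‖g x‖ₑ := by
        refine enorm_sub_le.trans (le_of_eq ?_)
        have h : ∀ r, ‖phase r x‖ₑ = 1 := fun r => by
          rw [← ofReal_norm, norm_phase]; simp
        rw [enorm_mul, enorm_mul, h, h]; ring
      calc _ ≤ (2 * ‖g x‖ₑ) ^ 2 := by gcongr
        _ = _ := by rw [mul_pow]; norm_num
    · rw [lintegral_const_mul' _ _ (by norm_num)]
      exact ENNReal.mul_ne_top (by norm_num) (lintegral_L2_lt_top g).ne
    · refine ae_of_all _ fun x => ?_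
      have hc : Continuous fun s => ‖phase s x * g x - phase t x * g x‖ₑ ^ 2 := by
        unfold phase; fun_prop
      simpa using hc.tendsto t
  rw [lintegral_zero] at hlim
  rw [ContinuousAt, tendsto_iff_edist_tendsto_0]
  simp_rw [edist_eq_enorm_sub]
  simp_rw [← hsq] at hlim
  have h := ((ENNReal.continuous_rpow_const (y := (1 / 2 : ℝ))).tendsto 0).comp hlim
  rw [ENNReal.zero_rpow_of_pos (by norm_num)] at h
  refine h.congr fun s => ?_
  rw [Function.comp_apply, ← ENNReal.rpow_natCast, ← ENNReal.rpow_mul]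
  norm_num

/-! ### Existence and uniqueness for the Schrödinger equation -/

/-- The bilinear pairing `∫ f g` on `L²`. -/
@[irreducible] def pairing : L2 d →L[ℂ] L2 d →L[ℂ] ℂ :=
  (ContinuousLinearMap.mul ℂ ℂ).lpPairing volume 2 2

lemma pairing_apply (f g : L2 d) : pairing f g = ∫ x, f x * g x := by
  unfold pairing
  exact ContinuousLinearMap.lpPairing_eq_integral _ _ _

/-- Moves the propagator onto the test function, where it is differentiable in norm. -/
lemma pairing_phaseMul_comm (f g : L2 d) (t : ℝ) :
    pairing (phaseMul t f) g = pairing f (phaseMul t g) := by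
  rw [pairing_apply, pairing_apply]
  apply integral_congr_ae
  filter_upwards [coeFn_phaseMul t f, coeFn_phaseMul t g] with x h1 h2
  rw [h1, h2]; ring

lemma pairing_toLp (f : L2 d) (ψ : 𝓢(Space d, ℂ)) :
    pairing f (toL2 ψ) = (f : 𝓢'(Space d, ℂ)) ψ := by
  rw [pairing_apply, Lp.toTemperedDistribution_apply]
  apply integral_congr_ae
  filter_upwards [coeFn_toL2 ψ] with x h
  rw [h, smul_eq_mul, mul_comm]

/-- Multiplication by `|x|²` on Schwartz functions. -/
def normSqMul (ψ : 𝓢(Space d, ℂ)) : 𝓢(Space d, ℂ) :=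
  SchwartzMap.smulLeftCLM ℂ (fun x : Space d => ((‖x‖ ^ 2 : ℝ) : ℂ)) ψ

lemma normSqMul_apply (ψ : 𝓢(Space d, ℂ)) (x : Space d) :
    normSqMul ψ x = ((‖x‖ ^ 2 : ℝ) : ℂ) * ψ x := by
  rw [normSqMul, SchwartzMap.smulLeftCLM_apply_apply (by fun_prop), smul_eq_mul]

lemma coeFn_toLp_normSqMul (ψ : 𝓢(Space d, ℂ)) :
    (toL2 (normSqMul ψ) : L2 d) =ᵐ[volume]
      fun x => (‖x‖ ^ 2 : ℝ) * (toL2 ψ : L2 d) x := by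
  filter_upwards [coeFn_toL2 (normSqMul ψ), coeFn_toL2 ψ] with x h1 h2
  rw [h1, h2, normSqMul_apply]

/-- Every Schwartz function has the form `𝓕 ψ`; testing against it moves the equation to the Fourier
side, where the Laplacian is a multiplication. -/
lemma coe_apply_fourier (v : L2 d) (ψ : 𝓢(Space d, ℂ)) :
    (v : 𝓢'(Space d, ℂ)) (𝓕 ψ) = pairing (𝓕 v) (toL2 ψ) := by
  rw [pairing_toLp, ← Lp.fourier_toTemperedDistribution_eq]; rfl

lemma laplacian_apply_fourier (v : L2 d) (ψ : 𝓢(Space d, ℂ)) :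
    (Δ (v : 𝓢'(Space d, ℂ))) (𝓕 ψ)
      = -(4 * Real.pi ^ 2) * pairing (𝓕 v) (toL2 (normSqMul ψ)) := by
  rw [TemperedDistribution.laplacian_eq_fourierMultiplierCLM, pairing_toLp,
    ← Lp.fourier_toTemperedDistribution_eq]
  simp [TemperedDistribution.fourierMultiplierCLM_apply, normSqMul]
  exact Or.inl (by ring)

lemma hasDerivAt_phaseMul_schwartz (ψ : 𝓢(Space d, ℂ)) (t : ℝ) :
    HasDerivAt (fun s => phaseMul s (toL2 ψ))
      ((-(4 * Real.pi ^ 2) * I : ℂ) • phaseMul t (toL2 (normSqMul ψ))) t :=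
  hasDerivAt_phaseMul (coeFn_toLp_normSqMul ψ) (coeFn_toLp_normSqMul _) t

/-- The free Schrödinger propagator. -/
def propagator (u₀ : L2 d) (t : ℝ) : L2 d := 𝓕⁻ (phaseMul t (𝓕 u₀))

lemma fourier_propagator (u₀ : L2 d) (t : ℝ) : 𝓕 (propagator u₀ t) = phaseMul t (𝓕 u₀) :=
  fourier_fourierInv_eq _

lemma isSchrodingerSolution_propagator (u₀ : L2 d) :
    IsSchrodingerSolution u₀ (propagator u₀) where
  continuous := (Lp.fourierTransformₗᵢ (Space d) ℂ).symm.continuous.comp (continuous_phaseMul _)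
  initial := by rw [propagator, phaseMul_zero]; exact fourierInv_fourier_eq _
  equation φ t := by
    obtain ⟨ψ, rfl⟩ : ∃ ψ, 𝓕 ψ = φ := ⟨𝓕⁻ φ, fourier_fourierInv_eq φ⟩
    simp_rw [coe_apply_fourier, laplacian_apply_fourier, fourier_propagator,
      pairing_phaseMul_comm]
    have := ((pairing (𝓕 u₀ : L2 d)).restrictScalars ℝ).hasFDerivAt.comp_hasDerivAt t
      (hasDerivAt_phaseMul_schwartz ψ t)
    refine this.congr_deriv ?_
    rw [ContinuousLinearMap.coe_restrictScalars', map_smul, smul_eq_mul]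
    ring

/-- Product rule for a bilinear pairing, differentiable in the weak sense in one factor. -/
lemma hasDerivAt_pairing {a b : ℝ → L2 d} {b' : L2 d} {D : ℂ} {t : ℝ} (ha : Continuous a)
    (hab : HasDerivAt (fun s => pairing (a s) (b t)) D t) (hb : HasDerivAt b b' t) :
    HasDerivAt (fun s => pairing (a s) (b s)) (D + pairing (a t) b') t := by
  rw [hasDerivAt_iff_tendsto_slope] at *
  -- The difference quotient splits into that of `a` against the fixed `b t` and the pairing of `a
  -- s` with the slope of `b`. The latter converges by joint continuity, so `a` itself need only be
  -- continuous.
  have h1 : Tendsto (fun s => pairing (a s) (slope b t s)) (𝓝[≠] t) (𝓝 (pairing (a t) b')) :=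
    ((pairing (d := d)).continuous₂.tendsto (a t, b')).comp
      (((ha.tendsto t).mono_left nhdsWithin_le_nhds).prodMk_nhds hb)
  refine (hab.add h1).congr fun s => ?_
  simp only [slope_def_module]
  have e : pairing (a s) ((s - t)⁻¹ • (b s - b t))
      = (s - t)⁻¹ • (pairing (a s) (b s) - pairing (a s) (b t)) := by
    rw [← map_sub]
    exact ((pairing (a s)).restrictScalars ℝ).map_smul _ _
  rw [e, ← smul_add]
  congr 1
  ring

/-- Compact support keeps the oscillating product a Schwartz function, hence admissible in the weak
equation. At `s = 0` it turns a bump function into a Schwartz function. -/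
lemma exists_schwartz_phase_mul {g : Space d → ℝ} (hg : ContDiff ℝ ((⊤ : ℕ∞) : WithTop ℕ∞) g)
    (hg' : HasCompactSupport g) (s : ℝ) :
    ∃ ψ : 𝓢(Space d, ℂ), ∀ x, ψ x = phase s x * g x := by
  have h1 : HasCompactSupport (fun x => phase s x * (g x : ℂ)) :=
    (hg'.comp_left (g := ((↑) : ℝ → ℂ)) rfl).mul_left
  have h2 : ContDiff ℝ ((⊤ : ℕ∞) : WithTop ℕ∞) (fun x : Space d => phase s x * (g x : ℂ)) := by
    unfold phase
    have h3 : ContDiff ℝ ((⊤ : ℕ∞) : WithTop ℕ∞) fun x : Space d => ‖x‖ ^ 2 := contDiff_norm_sq ℝ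
    have h4 : ContDiff ℝ ((⊤ : ℕ∞) : WithTop ℕ∞) fun x : ℝ => (x : ℂ) := ofRealCLM.contDiff
    exact (contDiff_const.mul (h4.comp ((contDiff_const.mul h3).mul contDiff_const))).cexp.mul
      (h4.comp hg)
  exact ⟨h1.toSchwartzMap h2, fun x => rfl⟩

lemma IsSchrodingerSolution.hasDerivAt_pairing_fourier {u₀ : L2 d} {u : ℝ → L2 d}
    (h : IsSchrodingerSolution u₀ u) (ψ : 𝓢(Space d, ℂ)) (t : ℝ) :
    HasDerivAt (fun s => pairing (𝓕 (u s)) (toL2 ψ))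
      (-(4 * Real.pi ^ 2) * I * pairing (𝓕 (u t)) (toL2 (normSqMul ψ))) t := by
  have := h.equation (𝓕 ψ) t
  simp_rw [coe_apply_fourier, laplacian_apply_fourier] at this
  exact this.congr_deriv (by ring)

/-- Undoing the evolution on the test function gives a quantity with zero derivative: the weak
equation for `u` cancels the norm derivative of the backward phase. -/
lemma IsSchrodingerSolution.pairing_fourier_eq {u₀ : L2 d} {u : ℝ → L2 d}
    (h : IsSchrodingerSolution u₀ u) (t : ℝ) {g : Space d → ℝ}
    (hg : ContDiff ℝ ((⊤ : ℕ∞) : WithTop ℕ∞) g) (hg' : HasCompactSupport g) (ψ : 𝓢(Space d, ℂ))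
    (hψ : ∀ x, ψ x = g x) :
    pairing (𝓕 (u t)) (phaseMul (-t) (toL2 ψ)) = pairing (𝓕 u₀) (toL2 ψ) := by
  have hc : Continuous fun s => (𝓕 (u s) : L2 d) :=
    (Lp.fourierTransformₗᵢ (Space d) ℂ).continuous.comp h.continuous
  have hd : ∀ t, HasDerivAt (fun s => pairing (𝓕 (u s)) (phaseMul (-s) (toL2 ψ))) 0 t := by
    intro t
    obtain ⟨χ, hχ⟩ := exists_schwartz_phase_mul hg hg' (-t)
    have e1 : phaseMul (-t) (toL2 ψ) = toL2 χ := by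
      apply Lp.ext
      filter_upwards [coeFn_phaseMul (-t) (toL2 ψ), coeFn_toL2 ψ,
        coeFn_toL2 χ] with x h1 h2 h3
      rw [h1, h2, h3, hχ, hψ]
    have e2 : phaseMul (-t) (toL2 (normSqMul ψ)) = toL2 (normSqMul χ) := by
      apply Lp.ext
      filter_upwards [coeFn_phaseMul (-t) (toL2 (normSqMul ψ)),
        coeFn_toL2 (normSqMul ψ), coeFn_toL2 (normSqMul χ)] with x h1 h2 h3
      rw [h1, h2, h3, normSqMul_apply, normSqMul_apply, hχ, hψ]
      ring
    have hb : HasDerivAt (fun s : ℝ => phaseMul (-s) (toL2 ψ))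
        ((4 * Real.pi ^ 2 * I : ℂ) • phaseMul (-t) (toL2 (normSqMul ψ))) t := by
      have e : ∀ w : L2 d, (-1 : ℝ) • ((-(4 * Real.pi ^ 2) * I : ℂ) • w) =
          (4 * Real.pi ^ 2 * I : ℂ) • w := fun w => by
        rw [neg_one_smul, neg_mul, neg_smul, neg_neg]
      rw [← e]
      exact HasDerivAt.scomp t (hasDerivAt_phaseMul_schwartz ψ (-t)) (hasDerivAt_neg t)
    have ha := h.hasDerivAt_pairing_fourier χ t
    rw [← e1] at ha
    have hD := hasDerivAt_pairing hc ha hb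
    rw [e2, map_smul, smul_eq_mul] at hD
    refine hD.congr_deriv ?_
    ring
  have := is_const_of_deriv_eq_zero (fun s => (hd s).differentiableAt) (fun s => (hd s).deriv)
    t 0
  simpa [phaseMul_zero, h.initial] using this

/-- Every solution of the free Schrödinger equation is given by the propagator. -/
lemma IsSchrodingerSolution.fourier_eq {u₀ : L2 d} {u : ℝ → L2 d}
    (h : IsSchrodingerSolution u₀ u) (t : ℝ) : 𝓕 (u t) = phaseMul t (𝓕 u₀) := by
  have hae : (phaseMul (-t) (𝓕 (u t)) : L2 d) =ᵐ[volume] (𝓕 u₀ : L2 d) := by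
    refine ae_eq_of_integral_contDiff_smul_eq ((Lp.memLp _).locallyIntegrable (by norm_num))
      ((Lp.memLp _).locallyIntegrable (by norm_num)) fun g hg hg' => ?_
    obtain ⟨ψ, hψ⟩ := exists_schwartz_phase_mul hg hg' 0
    simp only [phase_zero, one_mul] at hψ
    have := h.pairing_fourier_eq t hg hg' ψ hψ
    rw [← pairing_phaseMul_comm, pairing_apply, pairing_apply] at this
    have e : ∀ v : L2 d, ∫ x, g x • v x = ∫ x, v x * (toL2 ψ : L2 d) x := by
      intro v
      apply integral_congr_ae
      filter_upwards [coeFn_toL2 ψ] with x h1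
      rw [h1, hψ, Complex.real_smul, mul_comm]
    rw [e, e, this]
  apply Lp.ext
  filter_upwards [hae, coeFn_phaseMul (-t) (𝓕 (u t)), coeFn_phaseMul t (𝓕 u₀)] with x h1 h2 h3
  rw [h3, ← h1, h2, ← mul_assoc, ← phase_add]
  simp

/-! ### The norms expressed through the Fourier transform of the datum -/

lemma measurePreserving_sub_right (ξ : Space d) :
    MeasurePreserving (fun η : Space d => η - ξ) volume volume :=
  MeasureTheory.measurePreserving_sub_right volume ξ

/-- The value is `⟨v, M v⟩` with `M` the bounded multiplication by a character, hence continuous on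
`L²`. Together with `continuous_autocorrelation` this reduces `fourier_modSq` to Schwartz functions.
-/
lemma continuous_fourier_modSq (ξ : Space d) : Continuous fun v : L2 d => 𝓕 (modSq v) ξ := by
  have hc : Continuous fun x : Space d => ((Real.fourierChar (-inner ℝ x ξ) : Circle) : ℂ) := by
    fun_prop
  have hmem : MemLp (fun x : Space d => ((Real.fourierChar (-inner ℝ x ξ) : Circle) : ℂ)) ∞
      volume :=
    memLp_top_of_bound hc.aestronglyMeasurable 1 (ae_of_all _ fun x => (Circle.norm_coe _).le)
  set M : L2 d →L[ℂ] L2 d := (ContinuousLinearMap.mul ℂ ℂ).holderL volume ∞ 2 2 (hmem.toLp _)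
    with hM
  have h : ∀ v : L2 d, 𝓕 (modSq v) ξ = inner ℂ v (M v) := by
    intro v
    rw [Real.fourier_eq, L2.inner_def]
    apply integral_congr_ae
    filter_upwards [hmem.coeFn_toLp,
      (ContinuousLinearMap.mul ℂ ℂ).coeFn_holder (r := 2) (hmem.toLp _) v] with x h1 h2
    rw [hM, ContinuousLinearMap.holderL_apply_apply, h2, h1, Circle.smul_def]
    simp only [modSq, ContinuousLinearMap.mul_apply', RCLike.inner_apply, smul_eq_mul]
    rw [mul_assoc, Complex.mul_conj, Complex.normSq_eq_norm_sq]
  simp_rw [h]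
  exact continuous_id.inner M.continuous

lemma continuous_autocorrelation (ξ : Space d) :
    Continuous fun F : L2 d => ∫ η, F η * conj (F (η - ξ)) := by
  have h : ∀ F : L2 d, ∫ η, F η * conj (F (η - ξ)) =
      inner ℂ (Lp.compMeasurePreserving _ (measurePreserving_sub_right ξ) F) F := by
    intro F
    rw [L2.inner_def]
    apply integral_congr_ae
    filter_upwards [Lp.coeFn_compMeasurePreserving F (measurePreserving_sub_right ξ)] with x h1
    rw [h1]
    simp
  simp_rw [h]
  exact (Lp.isometry_compMeasurePreserving (measurePreserving_sub_right ξ)).continuous.inner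
    continuous_id

lemma fourier_conj_sub (ψ : 𝓢(Space d, ℂ)) (ξ x : Space d) :
    𝓕 (fun η : Space d => conj ((𝓕 ψ) (η - ξ))) x
      = ((Real.fourierChar (-inner ℝ x ξ) : Circle) : ℂ) * conj (ψ x) := by
  rw [Real.fourier_eq]
  rw [← integral_add_right_eq_self _ ξ]
  have h : ∀ η, (Real.fourierChar (-inner ℝ (η + ξ) x)) • conj ((𝓕 ψ) (η + ξ - ξ))
      = ((Real.fourierChar (-inner ℝ x ξ) : Circle) : ℂ) *
        conj ((Real.fourierChar (inner ℝ η x)) • (𝓕 ψ) η) := by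
    intro η
    rw [add_sub_cancel_right, inner_add_left, neg_add, AddChar.map_add_eq_mul,
      real_inner_comm x η, real_inner_comm x ξ, Circle.smul_def, Circle.smul_def, smul_eq_mul, smul_eq_mul,
      map_mul,
      AddChar.map_neg_eq_inv, Circle.coe_mul, Circle.coe_inv_eq_conj]
    ring
  simp_rw [h]
  rw [integral_const_mul, integral_conj]
  congr 2
  rw [← Real.fourierInv_eq, ← SchwartzMap.fourierInv_coe]
  simp

/-- The Fourier transform of `|v|²` is the autocorrelation of the Fourier transform of `v`. -/
lemma fourier_modSq (v : L2 d) (ξ : Space d) :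
    𝓕 (modSq v) ξ = ∫ η, (𝓕 v : L2 d) η * conj ((𝓕 v : L2 d) (η - ξ)) := by
  refine DenseRange.induction_on (p := fun v : L2 d => 𝓕 (modSq v) ξ =
    ∫ η, (𝓕 v : L2 d) η * conj ((𝓕 v : L2 d) (η - ξ)))
    (SchwartzMap.denseRange_toLpCLM (p := 2) ENNReal.ofNat_ne_top) v ?_ ?_
  · exact isClosed_eq (continuous_fourier_modSq ξ) ((continuous_autocorrelation ξ).comp
      (Lp.fourierTransformₗᵢ (Space d) ℂ).continuous)
  intro ψ
  rw [SchwartzMap.toLpCLM_apply, SchwartzMap.toLp_fourier_eq]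
  have h1 := ψ.coeFn_toLp 2 volume
  have h2 := (𝓕 ψ).coeFn_toLp 2 volume
  have h3 := (measurePreserving_sub_right ξ).quasiMeasurePreserving.ae_eq_comp h2
  have e1 : ∫ η, ((𝓕 ψ).toLp 2 : L2 d) η * conj (((𝓕 ψ).toLp 2 : L2 d) (η - ξ))
      = ∫ η, (𝓕 ψ) η * conj ((𝓕 ψ) (η - ξ)) := by
    apply integral_congr_ae
    filter_upwards [h2, h3] with η a b
    simp only [Function.comp_apply] at b
    rw [a, b]
  have e2 : 𝓕 (modSq (ψ.toLp 2 : L2 d)) ξ =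
      ∫ x, ψ x * (((Real.fourierChar (-inner ℝ x ξ) : Circle) : ℂ) * conj (ψ x)) := by
    rw [Real.fourier_eq]
    apply integral_congr_ae
    filter_upwards [h1] with x a
    rw [modSq, a, Circle.smul_def, smul_eq_mul, ← Complex.normSq_eq_norm_sq, ← Complex.mul_conj]
    ring
  rw [e1, e2]
  simp_rw [← fourier_conj_sub]
  have hint : Integrable (fun η => conj ((𝓕 ψ) (η - ξ))) :=
    (Complex.conjCLE.integrable_comp_iff).2 ((𝓕 ψ).integrable.comp_sub_right ξ)
  -- The multiplication formula `∫ 𝓕ψ · g = ∫ ψ · 𝓕g`, with `g` the conjugated translate of `𝓕 ψ`.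
  have := VectorFourier.integral_fourierIntegral_smul_eq_flip (L := innerₗ (Space d))
    (μ := volume) (ν := volume) Real.continuous_fourierChar continuous_inner ψ.integrable hint
  rw [flip_innerₗ] at this
  exact this.symm

lemma enorm_ofReal_of_nonneg {x : ℝ} (hx : 0 ≤ x) : ‖(x : ℂ)‖ₑ = ENNReal.ofReal x := by
  rw [← ofReal_norm, Complex.norm_real, Real.norm_of_nonneg hx]

/-- Outside `L²` both sides are `∞`, so the case distinction in the definition disappears and
Plancherel treats the rest. -/
lemma fracLaplacianNorm_sq (s : ℝ) {F : Space d → ℂ} (hF : AEStronglyMeasurable F volume) :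
    fracLaplacianNorm s F ^ 2 = ∫⁻ ξ, ‖applySymbol s F ξ‖ₑ ^ 2 := by
  unfold fracLaplacianNorm
  split_ifs with h
  · have : ‖(𝓕⁻ (h.toLp (applySymbol s F)) : L2 d)‖ₑ = ‖h.toLp (applySymbol s F)‖ₑ :=
      (Lp.fourierTransformₗᵢ (Space d) ℂ).symm.enorm_map _
    rw [this, Lp.enorm_toLp, eLpNorm_two_sq]
  · have hm : AEStronglyMeasurable (applySymbol s F) volume := by
      unfold applySymbol
      refine AEStronglyMeasurable.mul ?_ hF
      exact (by fun_prop : Measurable fun ξ : Space d =>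
        (((2 * Real.pi * ‖ξ‖) ^ (2 * s) : ℝ) : ℂ)).aestronglyMeasurable
    have : eLpNorm (applySymbol s F) 2 volume = ∞ := by
      by_contra hne
      exact h ⟨hm, lt_top_iff_ne_top.2 hne⟩
    rw [← eLpNorm_two_sq, this]

lemma homSobolevNorm_one_sq (u₀ : L2 d) :
    homSobolevNorm 1 u₀ ^ 2 = ENNReal.ofReal ((2 * Real.pi) ^ 2) *
      ∫⁻ ξ, ‖ξ‖ₑ ^ 2 * ‖(𝓕 u₀ : L2 d) ξ‖ₑ ^ 2 := by
  rw [homSobolevNorm, fracLaplacianNorm_sq _ (Lp.aestronglyMeasurable _),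
    ← lintegral_const_mul' _ _ ENNReal.ofReal_ne_top]
  congr with ξ
  rw [applySymbol, enorm_mul, mul_pow, ← mul_assoc]
  congr 1
  rw [show (2 * (1 / 2) : ℝ) = 1 by norm_num, Real.rpow_one, enorm_ofReal_of_nonneg (by positivity),
    ENNReal.ofReal_mul (by positivity), mul_pow,
    ofReal_norm, ← ENNReal.ofReal_pow (by positivity)]

/-- Since `|η|² - |η-ξ|² = 2 η·ξ - |ξ|²`, the two propagator phases combine into one that is linear
in `η`; the factor from `|ξ|²` leaves the integral and has modulus one. -/
lemma spaceTimeNormSq_eq {u₀ : L2 d} {u : ℝ → L2 d} (h : IsSchrodingerSolution u₀ u) (s : ℝ) :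
    spaceTimeNormSq s u = ∫⁻ t : ℝ, ∫⁻ ξ, ENNReal.ofReal ((2 * Real.pi * ‖ξ‖) ^ (4 * s)) *
      ‖∫ η, (𝓕 u₀ : L2 d) η * conj ((𝓕 u₀ : L2 d) (η - ξ)) *
        cexp (I * ((-(8 * Real.pi ^ 2) * t * inner ℝ η ξ : ℝ) : ℂ))‖ₑ ^ 2 := by
  unfold spaceTimeNormSq
  congr with t
  have hm : AEStronglyMeasurable (𝓕 (modSq (u t))) volume := by
    have hi : Integrable (modSq (u t)) volume :=
      ((memLp_two_iff_integrable_sq_norm (Lp.aestronglyMeasurable _)).1 (Lp.memLp (u t))).ofReal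
    exact (VectorFourier.fourierIntegral_continuous Real.continuous_fourierChar
      (L := innerₗ (Space d)) continuous_inner hi).aestronglyMeasurable
  rw [fracLaplacianNorm_sq _ hm]
  congr with ξ
  rw [applySymbol, enorm_mul, mul_pow]
  congr 1
  · rw [enorm_ofReal_of_nonneg (by positivity),
      ← ENNReal.ofReal_pow (by positivity), ← Real.rpow_natCast, ← Real.rpow_mul (by positivity)]
    congr 2; push_cast; ring
  · rw [fourier_modSq, h.fourier_eq]
    congr 1
    have e : ∫ η, (phaseMul t (𝓕 u₀) : L2 d) η * conj ((phaseMul t (𝓕 u₀) : L2 d) (η - ξ))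
        = ∫ η, phase (-t) ξ * ((𝓕 u₀ : L2 d) η * conj ((𝓕 u₀ : L2 d) (η - ξ)) *
        cexp (I * ((-(8 * Real.pi ^ 2) * t * inner ℝ η ξ : ℝ) : ℂ))) := by
      have h2 := coeFn_phaseMul t (𝓕 u₀)
      have h3 := (measurePreserving_sub_right ξ).quasiMeasurePreserving.ae_eq_comp h2
      apply integral_congr_ae
      filter_upwards [h2, h3] with η a b
      simp only [Function.comp_apply] at b
      rw [a, b, map_mul]
      have : phase t η * conj (phase t (η - ξ)) = phase (-t) ξ *
          cexp (I * ((-(8 * Real.pi ^ 2) * t * inner ℝ η ξ : ℝ) : ℂ)) := by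
        have h4 : ‖η - ξ‖ ^ 2 = ‖η‖ ^ 2 - 2 * inner ℝ η ξ + ‖ξ‖ ^ 2 := norm_sub_sq_real η ξ
        simp only [phase, ← Complex.exp_conj, ← Complex.exp_add, map_mul,
          Complex.conj_I, Complex.conj_ofReal, h4]
        congr 1
        push_cast
        ring
      linear_combination ((𝓕 u₀ : L2 d) η * conj ((𝓕 u₀ : L2 d) (η - ξ))) * this
    rw [e, integral_const_mul, enorm_mul]
    have : ‖phase (-t) ξ‖ₑ = 1 := by
      rw [← ofReal_norm]; simp
    rw [this, one_mul]

/-- The Bessel weight gives `(1+|ξ|²)|F|² = |F|² + |ξ|²|F|²`, whose first term is always integrable.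
The distributional condition becomes an almost everywhere identity by testing with bump functions.
-/
lemma memH1_iff (u₀ : L2 d) :
    MemH1 u₀ ↔ ∫⁻ ξ, ‖ξ‖ₑ ^ 2 * ‖(𝓕 u₀ : L2 d) ξ‖ₑ ^ 2 < ∞ := by
  set F : L2 d := 𝓕 u₀ with hF
  have hw : Continuous fun x : Space d => (((1 + ‖x‖ ^ 2) ^ ((1 : ℝ) / 2) : ℝ) : ℂ) := by
    refine continuous_ofReal.comp ?_
    exact (by fun_prop : Continuous fun x : Space d => 1 + ‖x‖ ^ 2).rpow_const
      fun x => Or.inl (by positivity)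
  have hFm := (Lp.stronglyMeasurable F).measurable
  have hsq : ∀ x : Space d, ‖(((1 + ‖x‖ ^ 2) ^ ((1 : ℝ) / 2) : ℝ) : ℂ) * F x‖ₑ ^ 2
      = ‖F x‖ₑ ^ 2 + ‖x‖ₑ ^ 2 * ‖F x‖ₑ ^ 2 := by
    intro x
    rw [enorm_mul, mul_pow, enorm_ofReal_of_nonneg (by positivity),
      ← ENNReal.ofReal_pow (by positivity), ← Real.rpow_natCast, ← Real.rpow_mul (by positivity)]
    norm_num
    rw [ENNReal.ofReal_add (by positivity) (by positivity), ENNReal.ofReal_pow (by positivity),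
      ofReal_norm, ENNReal.ofReal_one, add_mul, one_mul]
  have hiff : MemLp (fun x : Space d => (((1 + ‖x‖ ^ 2) ^ ((1 : ℝ) / 2) : ℝ) : ℂ) * F x) 2 volume
      ↔ ∫⁻ ξ, ‖ξ‖ₑ ^ 2 * ‖F ξ‖ₑ ^ 2 < ∞ := by
    have hm : AEStronglyMeasurable
        (fun x : Space d => (((1 + ‖x‖ ^ 2) ^ ((1 : ℝ) / 2) : ℝ) : ℂ) * F x) volume :=
      (hw.measurable.mul hFm).aestronglyMeasurable
    have h2 : ∀ x : ℝ≥0∞, x < ∞ ↔ x ^ 2 < ∞ := by simp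
    rw [MemLp, and_iff_right hm, h2, eLpNorm_two_sq]
    simp_rw [hsq]
    rw [lintegral_add_left (hFm.enorm.pow_const 2), ENNReal.add_lt_top,
      and_iff_right (lintegral_L2_lt_top F)]
  rw [← hiff, MemH1, TemperedDistribution.memSobolev_iff_exists_smulLeftCLM_fourier,
    Lp.fourier_toTemperedDistribution_eq, ← hF]
  have htg : (fun x : Space d => (((1 + ‖x‖ ^ 2) ^ ((1 : ℝ) / 2) : ℝ) : ℂ)).HasTemperateGrowth := by
    have := Function.hasTemperateGrowth_one_add_norm_sq_rpow (Space d) ((1 : ℝ) / 2)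
    fun_prop
  constructor
  · rintro ⟨f', hf'⟩
    refine (Lp.memLp f').ae_eq ?_
    refine ae_eq_of_integral_contDiff_smul_eq ((Lp.memLp _).locallyIntegrable (by norm_num))
      (((Lp.memLp F).locallyIntegrable (by norm_num)).continuous_smul hw) fun g hg hg' => ?_
    obtain ⟨ψ, hψ⟩ := exists_schwartz_phase_mul hg hg' 0
    simp only [phase_zero, one_mul] at hψ
    have := DFunLike.congr_fun hf' ψ
    rw [TemperedDistribution.smulLeftCLM_apply_apply, Lp.toTemperedDistribution_apply,
      Lp.toTemperedDistribution_apply] at this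
    simp_rw [SchwartzMap.smulLeftCLM_apply_apply htg, hψ] at this
    simp only [Complex.real_smul, smul_eq_mul] at this ⊢
    rw [← this]
    congr with x
    ring
  · intro h
    refine ⟨h.toLp _, ?_⟩
    ext φ
    rw [TemperedDistribution.smulLeftCLM_apply_apply, Lp.toTemperedDistribution_apply,
      Lp.toTemperedDistribution_apply]
    apply integral_congr_ae
    filter_upwards [h.coeFn_toLp] with x hx
    rw [hx, SchwartzMap.smulLeftCLM_apply_apply htg]
    simp only [smul_eq_mul]
    ring

/-! ### Plancherel's identity for the Fourier integral on `L¹ ∩ L²` -/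

section Plancherel

variable {V : Type*} [NormedAddCommGroup V] [InnerProductSpace ℝ V] [FiniteDimensional ℝ V]
  [MeasurableSpace V] [BorelSpace V]

lemma integral_fourier_mul_eq {f g : V → ℂ} (hf : Integrable f) (hg : Integrable g) :
    ∫ x, 𝓕 f x * g x = ∫ x, f x * 𝓕 g x := by
  have := VectorFourier.integral_fourierIntegral_smul_eq_flip (L := innerₗ V)
    (μ := volume) (ν := volume) Real.continuous_fourierChar continuous_inner hf hg
  rw [flip_innerₗ] at this
  exact this

lemma continuous_fourier_of_integrable {f : V → ℂ} (hf : Integrable f) : Continuous (𝓕 f) :=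
  VectorFourier.fourierIntegral_continuous Real.continuous_fourierChar
    (L := innerₗ V) continuous_inner hf

/-- Both transforms agree as distributions by the multiplication formula, and locally integrable
functions are determined by their integrals against bump functions. -/
lemma coeFn_fourier_toLp {f : V → ℂ} (hf : Integrable f) (hf2 : MemLp f 2) :
    (𝓕 (hf2.toLp f) : Lp ℂ 2 (volume : Measure V)) =ᵐ[volume] 𝓕 f := by
  refine ae_eq_of_integral_contDiff_smul_eq ((Lp.memLp _).locallyIntegrable (by norm_num))
    (continuous_fourier_of_integrable hf).locallyIntegrable fun g hg hg' => ?_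
  have h1 : HasCompactSupport (fun x => (g x : ℂ)) := hg'.comp_left (g := ((↑) : ℝ → ℂ)) rfl
  have h2 : ContDiff ℝ ((⊤ : ℕ∞) : WithTop ℕ∞) (fun x => (g x : ℂ)) := ofRealCLM.contDiff.comp hg
  set ψ : 𝓢(V, ℂ) := h1.toSchwartzMap h2
  have hψ : ∀ x, ψ x = g x := fun x => rfl
  have key := DFunLike.congr_fun (Lp.fourier_toTemperedDistribution_eq (hf2.toLp f)) ψ
  rw [TemperedDistribution.fourier_apply, Lp.toTemperedDistribution_apply,
    Lp.toTemperedDistribution_apply] at key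
  simp only [Complex.real_smul]
  simp_rw [hψ, smul_eq_mul] at key
  rw [← key]
  simp_rw [← hψ]
  rw [← integral_fourier_mul_eq ψ.integrable hf]
  apply integral_congr_ae
  filter_upwards [hf2.coeFn_toLp] with x hx
  rw [hx]; rfl

lemma lintegral_fourier_sq {f : V → ℂ} (hf : Integrable f) (hf2 : MemLp f 2) :
    ∫⁻ x, ‖𝓕 f x‖ₑ ^ 2 = ∫⁻ x, ‖f x‖ₑ ^ 2 := by
  have h : ‖(𝓕 (hf2.toLp f) : Lp ℂ 2 (volume : Measure V))‖ₑ = ‖hf2.toLp f‖ₑ :=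
    (Lp.fourierTransformₗᵢ V ℂ).enorm_map _
  rw [Lp.enorm_toLp, Lp.enorm_def, eLpNorm_congr_ae (coeFn_fourier_toLp hf hf2)] at h
  rw [← eLpNorm_two_sq, ← eLpNorm_two_sq, h]

end Plancherel

/-! ### Cauchy–Schwarz with remainder -/

section Lagrange

variable {Y : Type*} [MeasurableSpace Y] {μ : Measure Y}

lemma memLp_two_of_lintegral {u : Y → ℂ} (hu : AEStronglyMeasurable u μ)
    (h : ∫⁻ y, ‖u y‖ₑ ^ 2 ∂μ < ∞) : MemLp u 2 μ := by
  refine ⟨hu, ?_⟩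
  have h2 : ∀ x : ℝ≥0∞, x < ∞ ↔ x ^ 2 < ∞ := by simp
  rwa [h2, eLpNorm_two_sq]

lemma lintegral_enorm_sq_eq {u : Y → ℂ} (hu : MemLp u 2 μ) :
    ∫⁻ y, ‖u y‖ₑ ^ 2 ∂μ = ENNReal.ofReal (∫ y, ‖u y‖ ^ 2 ∂μ) := by
  rw [ofReal_integral_eq_lintegral_ofReal ((memLp_two_iff_integrable_sq_norm hu.1).1 hu)
    (ae_of_all _ fun y => by positivity)]
  congr with y
  rw [ENNReal.ofReal_pow (by positivity), ofReal_norm]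

variable [SFinite μ]

/-- Lagrange's identity, i.e. the Cauchy–Schwarz inequality with its defect. -/
lemma enorm_integral_mul_conj_sq_add {u v : Y → ℂ} (hu : MemLp u 2 μ) (hv : MemLp v 2 μ) :
    ‖∫ y, u y * conj (v y) ∂μ‖ₑ ^ 2 +
      2⁻¹ * ∫⁻ y, ∫⁻ z, ‖u y * v z - u z * v y‖ₑ ^ 2 ∂μ ∂μ
      = (∫⁻ y, ‖u y‖ₑ ^ 2 ∂μ) * ∫⁻ y, ‖v y‖ₑ ^ 2 ∂μ := by
  have hu2 := (memLp_two_iff_integrable_sq_norm hu.1).1 hu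
  have hv2 := (memLp_two_iff_integrable_sq_norm hv.1).1 hv
  have huv : Integrable (fun y => u y * conj (v y)) μ := hu.integrable_mul hv.star
  have i1 : Integrable (fun p : Y × Y => ‖u p.1‖ ^ 2 * ‖v p.2‖ ^ 2) (μ.prod μ) := hu2.mul_prod hv2
  have i2 : Integrable (fun p : Y × Y => ‖v p.1‖ ^ 2 * ‖u p.2‖ ^ 2) (μ.prod μ) := hv2.mul_prod hu2
  have i3 : Integrable (fun p : Y × Y => u p.1 * conj (v p.1) * conj (u p.2 * conj (v p.2)))
      (μ.prod μ) := huv.mul_prod ((Complex.conjCLE.integrable_comp_iff).2 huv)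
  have i12 : Integrable (fun p : Y × Y => ‖u p.1‖ ^ 2 * ‖v p.2‖ ^ 2 + ‖v p.1‖ ^ 2 * ‖u p.2‖ ^ 2)
      (μ.prod μ) := i1.add i2
  have i3' : Integrable (fun p : Y × Y =>
      2 * (u p.1 * conj (v p.1) * conj (u p.2 * conj (v p.2))).re) (μ.prod μ) := i3.re.const_mul 2
  set W := ∫ y, u y * conj (v y) ∂μ with hW
  set A := ∫ y, ‖u y‖ ^ 2 ∂μ with hA
  set B := ∫ y, ‖v y‖ ^ 2 ∂μ with hB
  -- The cross term is `u conj v` at one point times its conjugate at the other, so it integrates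
  -- over the product to `|W|²`.
  have hpt : ∀ p : Y × Y, ‖u p.1 * v p.2 - u p.2 * v p.1‖ ^ 2 = ‖u p.1‖ ^ 2 * ‖v p.2‖ ^ 2 +
      ‖v p.1‖ ^ 2 * ‖u p.2‖ ^ 2 -
      2 * (u p.1 * conj (v p.1) * conj (u p.2 * conj (v p.2))).re := by
    intro p
    simp only [← Complex.normSq_eq_norm_sq, Complex.normSq_sub, map_mul, Complex.conj_conj]
    rw [show u p.1 * v p.2 * (conj (u p.2) * conj (v p.1)) =
      u p.1 * conj (v p.1) * (conj (u p.2) * v p.2) by ring]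
    ring
  have hI : Integrable (fun p : Y × Y => ‖u p.1 * v p.2 - u p.2 * v p.1‖ ^ 2) (μ.prod μ) := by
    simp_rw [hpt]
    exact i12.sub i3'
  have hval : ∫ p : Y × Y, ‖u p.1 * v p.2 - u p.2 * v p.1‖ ^ 2 ∂(μ.prod μ)
      = 2 * (A * B) - 2 * ‖W‖ ^ 2 := by
    simp_rw [hpt]
    rw [integral_sub i12 i3', integral_add i1 i2, integral_const_mul,
      integral_prod_mul (fun y => ‖u y‖ ^ 2) (fun y => ‖v y‖ ^ 2),
      integral_prod_mul (fun y => ‖v y‖ ^ 2) (fun y => ‖u y‖ ^ 2)]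
    have h3 : ∫ p : Y × Y, (u p.1 * conj (v p.1) * conj (u p.2 * conj (v p.2))).re ∂(μ.prod μ)
        = ‖W‖ ^ 2 := by
      have := integral_re (𝕜 := ℂ) i3
      simp only [RCLike.re_to_complex] at this
      rw [this, integral_prod_mul (fun y => u y * conj (v y)) (fun y => conj (u y * conj (v y))),
        integral_conj, Complex.mul_conj, Complex.normSq_eq_norm_sq, Complex.ofReal_re]
    rw [h3]; ring
  have hl : ∫⁻ y, ∫⁻ z, ‖u y * v z - u z * v y‖ₑ ^ 2 ∂μ ∂μ
      = ENNReal.ofReal (2 * (A * B) - 2 * ‖W‖ ^ 2) := by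
    rw [← hval, ofReal_integral_eq_lintegral_ofReal hI (ae_of_all _ fun p => by positivity),
      lintegral_prod _ hI.1.aemeasurable.ennreal_ofReal]
    congr with y
    congr with z
    rw [ENNReal.ofReal_pow (by positivity), ofReal_norm]
  have hnn : 0 ≤ 2 * (A * B) - 2 * ‖W‖ ^ 2 := by
    rw [← hval]; exact integral_nonneg fun p => by positivity
  have hA0 : 0 ≤ A := integral_nonneg fun y => by positivity
  rw [hl, lintegral_enorm_sq_eq hu, lintegral_enorm_sq_eq hv, ← ENNReal.ofReal_mul hA0,
    ← ofReal_norm, ← ENNReal.ofReal_pow (by positivity),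
    show (2⁻¹ : ℝ≥0∞) = ENNReal.ofReal 2⁻¹ by rw [ENNReal.ofReal_inv_of_pos] <;> norm_num,
    ← ENNReal.ofReal_mul (by norm_num), ← ENNReal.ofReal_add (by positivity) (by positivity)]
  congr 1
  ring

end Lagrange

/-! ### The identity for a fixed direction -/

section Strip

variable {Y : Type*} [MeasurableSpace Y] {μ : Measure Y} [SFinite μ]

/-- The integral over `Y` leaves the one-dimensional transform of `H` at `τ`. Plancherel removes
`τ`, and Lagrange's identity applies in `Y` for almost every `r`. -/
lemma strip_identity_of_shift {f : ℝ × Y → ℂ} (hf : Measurable f)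
    (hf2 : ∫⁻ r, ∫⁻ y, ‖f (r, y)‖ₑ ^ 2 ∂μ < ∞) (ρ : ℝ)
    (hfin : ∫⁻ r, (∫⁻ y, ‖f (r, y)‖ₑ ^ 2 ∂μ) * ∫⁻ z, ‖f (r - ρ, z)‖ₑ ^ 2 ∂μ < ∞) :
    (∫⁻ τ : ℝ, ‖∫ p : ℝ × Y, f p * conj (f (p.1 - ρ, p.2)) *
        cexp (I * ((-(2 * Real.pi) * τ * p.1 : ℝ) : ℂ)) ∂(volume.prod μ)‖ₑ ^ 2) +
      2⁻¹ * ∫⁻ r, ∫⁻ y, ∫⁻ z,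
        ‖f (r, y) * f (r - ρ, z) - f (r, z) * f (r - ρ, y)‖ₑ ^ 2 ∂μ ∂μ
      = ∫⁻ r, (∫⁻ y, ‖f (r, y)‖ₑ ^ 2 ∂μ) * ∫⁻ z, ‖f (r - ρ, z)‖ₑ ^ 2 ∂μ := by
  have hshift : MeasurePreserving (fun r : ℝ => r - ρ) volume volume :=
    MeasureTheory.measurePreserving_sub_right volume ρ
  have hshift2 : MeasurePreserving (fun p : ℝ × Y => (p.1 - ρ, p.2)) (volume.prod μ)
      (volume.prod μ) := hshift.prod (MeasurePreserving.id μ)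
  have hm : MemLp f 2 (volume.prod μ) := by
    apply memLp_two_of_lintegral hf.aestronglyMeasurable
    rwa [lintegral_prod _ (hf.enorm.pow_const 2).aemeasurable]
  have hm' : MemLp (fun p : ℝ × Y => f (p.1 - ρ, p.2)) 2 (volume.prod μ) :=
    hm.comp_measurePreserving hshift2
  have hG : Integrable (fun p : ℝ × Y => f p * conj (f (p.1 - ρ, p.2))) (volume.prod μ) :=
    hm.integrable_mul hm'.star
  set H : ℝ → ℂ := fun r => ∫ y, f (r, y) * conj (f (r - ρ, y)) ∂μ with hH
  have hHi : Integrable H := hG.integral_prod_left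
  have hN : ∀ᵐ r : ℝ, ∫⁻ y, ‖f (r, y)‖ₑ ^ 2 ∂μ < ∞ :=
    ae_lt_top (hf.enorm.pow_const 2).lintegral_prod_right' hf2.ne
  have hN' : ∀ᵐ r : ℝ, ∫⁻ y, ‖f (r - ρ, y)‖ₑ ^ 2 ∂μ < ∞ :=
    hshift.quasiMeasurePreserving.ae hN
  have hLag : ∀ᵐ r : ℝ, ‖H r‖ₑ ^ 2 + 2⁻¹ * ∫⁻ y, ∫⁻ z,
        ‖f (r, y) * f (r - ρ, z) - f (r, z) * f (r - ρ, y)‖ₑ ^ 2 ∂μ ∂μ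
      = (∫⁻ y, ‖f (r, y)‖ₑ ^ 2 ∂μ) * ∫⁻ z, ‖f (r - ρ, z)‖ₑ ^ 2 ∂μ := by
    filter_upwards [hN, hN'] with r h1 h2
    exact enorm_integral_mul_conj_sq_add
      (memLp_two_of_lintegral (hf.comp measurable_prodMk_left).aestronglyMeasurable h1)
      (memLp_two_of_lintegral (hf.comp measurable_prodMk_left).aestronglyMeasurable h2)
  -- Plancherel needs `H` in `L²`; this follows from the Cauchy–Schwarz bound and the finiteness
  -- hypothesis.
  have hH2 : MemLp H 2 := by
    apply memLp_two_of_lintegral hHi.1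
    refine lt_of_le_of_lt (lintegral_mono_ae ?_) hfin
    filter_upwards [hLag] with r hr
    rw [← hr]
    exact le_self_add
  have hF : ∀ τ : ℝ, ∫ p : ℝ × Y, f p * conj (f (p.1 - ρ, p.2)) *
        cexp (I * ((-(2 * Real.pi) * τ * p.1 : ℝ) : ℂ)) ∂(volume.prod μ) = 𝓕 H τ := by
    intro τ
    rw [Real.fourier_real_eq_integral_exp_smul, integral_prod]
    · congr with r
      dsimp only
      rw [integral_mul_const, smul_eq_mul, mul_comm]
      congr 2
      push_cast; ring
    · refine hG.mul_bdd (c := 1) (by fun_prop) (ae_of_all _ fun p => ?_)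
      rw [mul_comm I, Complex.norm_exp_ofReal_mul_I]
  simp_rw [hF]
  rw [lintegral_fourier_sq hHi hH2, ← lintegral_const_mul' _ _ (by norm_num),
    ← lintegral_add_left' (hHi.1.enorm.pow_const 2)]
  exact lintegral_congr_ae hLag

lemma strip_identity {f : ℝ × Y → ℂ} (hf : Measurable f)
    (hf2 : ∫⁻ r, ∫⁻ y, ‖f (r, y)‖ₑ ^ 2 ∂μ < ∞)
    (hfin : ∫⁻ ρ in Set.Ioi (0 : ℝ), ENNReal.ofReal (ρ ^ 2) *
      ∫⁻ r, (∫⁻ y, ‖f (r, y)‖ₑ ^ 2 ∂μ) * ∫⁻ z, ‖f (r - ρ, z)‖ₑ ^ 2 ∂μ < ∞) :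
    (∫⁻ ρ in Set.Ioi (0 : ℝ), ENNReal.ofReal (ρ ^ 2) *
      ∫⁻ τ : ℝ, ‖∫ p : ℝ × Y, f p * conj (f (p.1 - ρ, p.2)) *
        cexp (I * ((-(2 * Real.pi) * τ * p.1 : ℝ) : ℂ)) ∂(volume.prod μ)‖ₑ ^ 2) +
      2⁻¹ * (∫⁻ ρ in Set.Ioi (0 : ℝ), ENNReal.ofReal (ρ ^ 2) * ∫⁻ r, ∫⁻ y, ∫⁻ z,
        ‖f (r, y) * f (r - ρ, z) - f (r, z) * f (r - ρ, y)‖ₑ ^ 2 ∂μ ∂μ)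
      = ∫⁻ ρ in Set.Ioi (0 : ℝ), ENNReal.ofReal (ρ ^ 2) *
        ∫⁻ r, (∫⁻ y, ‖f (r, y)‖ₑ ^ 2 ∂μ) * ∫⁻ z, ‖f (r - ρ, z)‖ₑ ^ 2 ∂μ := by
  have hmeasD : Measurable fun ρ : ℝ => ENNReal.ofReal (ρ ^ 2) * ∫⁻ r, ∫⁻ y, ∫⁻ z,
        ‖f (r, y) * f (r - ρ, z) - f (r, z) * f (r - ρ, y)‖ₑ ^ 2 ∂μ ∂μ := by
    refine Measurable.mul (by fun_prop) ?_
    have : Measurable fun q : ((ℝ × ℝ) × Y) × Y => ‖f (q.1.1.2, q.1.2) * f (q.1.1.2 - q.1.1.1, q.2)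
        - f (q.1.1.2, q.2) * f (q.1.1.2 - q.1.1.1, q.1.2)‖ₑ ^ 2 := by fun_prop
    exact this.lintegral_prod_right'.lintegral_prod_right'.lintegral_prod_right'
  have hmeasR : Measurable fun ρ : ℝ => ENNReal.ofReal (ρ ^ 2) *
      ∫⁻ r, (∫⁻ y, ‖f (r, y)‖ₑ ^ 2 ∂μ) * ∫⁻ z, ‖f (r - ρ, z)‖ₑ ^ 2 ∂μ := by
    refine Measurable.mul (by fun_prop) ?_
    have hn : Measurable fun r : ℝ => ∫⁻ y, ‖f (r, y)‖ₑ ^ 2 ∂μ :=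
      (hf.enorm.pow_const 2).lintegral_prod_right'
    have : Measurable fun q : ℝ × ℝ => (∫⁻ y, ‖f (q.2, y)‖ₑ ^ 2 ∂μ) *
      ∫⁻ z, ‖f (q.2 - q.1, z)‖ₑ ^ 2 ∂μ :=
      (hn.comp measurable_snd).mul (hn.comp (measurable_snd.sub measurable_fst))
    exact this.lintegral_prod_right'
  rw [← lintegral_const_mul' _ _ (by norm_num), ← lintegral_add_right _ (hmeasD.const_mul _)]
  apply lintegral_congr_ae
  filter_upwards [ae_lt_top hmeasR hfin.ne, ae_restrict_mem measurableSet_Ioi] with ρ h1 h2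
  -- As the weight is nonzero, finiteness of the weighted integrand for almost every `ρ` passes to
  -- the unweighted one.
  have hρ : ENNReal.ofReal (ρ ^ 2) ≠ 0 := by
    have : 0 < ρ := h2
    simpa using this.ne'
  rw [← strip_identity_of_shift hf hf2 ρ (ENNReal.lt_top_of_mul_ne_top_right h1.ne hρ), mul_add]
  ring

end Strip

/-- The first component of the elastic collision `(a, b) ↦ (a', b')` in the direction `ω`. The
second component `b'` is `collide ω b a`. -/
def collide {d : ℕ} (ω a b : Space d) : Space d := a - inner ℝ (a - b) ω • ω

lemma measurable_collide {d : ℕ} {X : Type*} [MeasurableSpace X] {ω a b : X → Space d}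
    (hω : Measurable ω) (ha : Measurable a) (hb : Measurable b) :
    Measurable fun x => collide (ω x) (a x) (b x) := by
  unfold collide; fun_prop

/-- Coordinates in an orthonormal basis starting with `ω`. Shifts along `ω` and collisions in
direction `ω` touch only the first coordinate. -/
lemma exists_coordinates {n : ℕ} {ω : Space (n + 1)} (hω : ‖ω‖ = 1) :
    ∃ Φ : Space (n + 1) ≃ᵐ ℝ × (Fin n → ℝ), MeasurePreserving Φ volume volume ∧
      (∀ x, (Φ x).1 = inner ℝ x ω) ∧ ∀ x (s : ℝ), Φ (x + s • ω) = ((Φ x).1 + s, (Φ x).2) := by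
  have ho : Orthonormal ℝ (({0} : Set (Fin (n + 1))).domRestrict fun _ => ω) := by
    refine ⟨fun i => hω, fun i j hij => (hij ?_).elim⟩
    exact Subtype.ext (i.2.trans j.2.symm)
  obtain ⟨b, hb⟩ := ho.exists_orthonormalBasis_extension_of_card_eq (ι := Fin (n + 1)) (by simp)
  have hb0 : b 0 = ω := hb 0 rfl
  set Φ : Space (n + 1) ≃ᵐ ℝ × (Fin n → ℝ) := b.measurableEquiv.trans
    ((MeasurableEquiv.toLp 2 (Fin (n + 1) → ℝ)).symm.trans
      (MeasurableEquiv.piFinSuccAbove (fun _ => ℝ) 0)) with hΦ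
  have h1 : ∀ x, (Φ x).1 = b.repr x 0 := fun x => rfl
  have h2 : ∀ x i, (Φ x).2 i = b.repr x i.succ := fun x i => rfl
  refine ⟨Φ, ?_, ?_, ?_⟩
  · exact (volume_preserving_piFinSuccAbove (fun _ => ℝ) 0).comp
      ((EuclideanSpace.volume_preserving_symm_measurableEquiv_toLp _).comp
        b.measurePreserving_measurableEquiv)
  · intro x
    rw [h1, b.repr_apply_apply, hb0, real_inner_comm]
  · intro x s
    have hr : b.repr ω = EuclideanSpace.single 0 1 := by rw [← hb0, b.repr_self]
    ext i
    · rw [h1, h1, map_add, map_smul, hr]; simp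
    · rw [h2, map_add, map_smul, hr]; simp [h2]

/-- Substitute `s = r - ρ` for the first coordinate of `b`; the positive part of `(a-b)·ω = ρ`
restricts the integral to `ρ > 0`. -/
lemma lintegral_lintegral_coordinates {n : ℕ} {ω : Space (n + 1)}
    {Φ : Space (n + 1) ≃ᵐ ℝ × (Fin n → ℝ)} (hΦ : MeasurePreserving Φ volume volume)
    (hΦ1 : ∀ x, (Φ x).1 = inner ℝ x ω)
    {k : (ℝ × (Fin n → ℝ)) → (ℝ × (Fin n → ℝ)) → ℝ≥0∞}
    (hk : Measurable (Function.uncurry k)) :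
    ∫⁻ a, ∫⁻ b, ENNReal.ofReal (inner ℝ (a - b) ω) ^ 2 * k (Φ a) (Φ b) =
      ∫⁻ ρ in Set.Ioi (0 : ℝ), ENNReal.ofReal (ρ ^ 2) *
        ∫⁻ r, ∫⁻ y, ∫⁻ z, k (r, y) (r - ρ, z) := by
  have hw : Measurable fun q : (ℝ × (Fin n → ℝ)) × (ℝ × (Fin n → ℝ)) =>
      ENNReal.ofReal (q.1.1 - q.2.1) ^ 2 * k q.1 q.2 := by
    have : Measurable fun q : (ℝ × (Fin n → ℝ)) × (ℝ × (Fin n → ℝ)) => k q.1 q.2 := hk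
    fun_prop
  calc ∫⁻ a, ∫⁻ b, ENNReal.ofReal (inner ℝ (a - b) ω) ^ 2 * k (Φ a) (Φ b)
      = ∫⁻ a, ∫⁻ b, ENNReal.ofReal ((Φ a).1 - (Φ b).1) ^ 2 * k (Φ a) (Φ b) := by
        simp_rw [hΦ1, ← inner_sub_left]
    _ = ∫⁻ p, ∫⁻ q : ℝ × (Fin n → ℝ), ENNReal.ofReal (p.1 - q.1) ^ 2 * k p q := by
        rw [← hΦ.lintegral_comp hw.lintegral_prod_right']
        congr with a
        exact (hΦ.lintegral_comp (hw.comp (measurable_prodMk_left (x := Φ a))))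
    _ = ∫⁻ r, ∫⁻ y, ∫⁻ s, ∫⁻ z, ENNReal.ofReal (r - s) ^ 2 * k (r, y) (s, z) := by
        rw [Measure.volume_eq_prod, lintegral_prod _ hw.lintegral_prod_right'.aemeasurable]
        congr with r
        congr with y
        exact lintegral_prod _ (hw.comp (measurable_prodMk_left (x := (r, y)))).aemeasurable
    _ = ∫⁻ r, ∫⁻ s, ∫⁻ y, ∫⁻ z, ENNReal.ofReal (r - s) ^ 2 * k (r, y) (s, z) := by
        congr with r
        rw [lintegral_lintegral_swap]
        refine Measurable.aemeasurable ?_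
        have : Measurable fun q : ((Fin n → ℝ) × ℝ) × (Fin n → ℝ) =>
            ENNReal.ofReal (r - q.1.2) ^ 2 * k (r, q.1.1) (q.1.2, q.2) :=
          hw.comp (f := fun q : ((Fin n → ℝ) × ℝ) × (Fin n → ℝ) => ((r, q.1.1), (q.1.2, q.2)))
            (by fun_prop)
        exact this.lintegral_prod_right'
    _ = ∫⁻ r, ∫⁻ ρ, ENNReal.ofReal ρ ^ 2 * ∫⁻ y, ∫⁻ z, k (r, y) (r - ρ, z) := by
        congr with r
        rw [← lintegral_sub_left_eq_self _ r]
        congr with ρ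
        rw [sub_sub_cancel, ← lintegral_const_mul' _ _ (by simp)]
        congr with y
        rw [lintegral_const_mul' _ _ (by simp)]
    _ = ∫⁻ ρ, ∫⁻ r, ENNReal.ofReal ρ ^ 2 * ∫⁻ y, ∫⁻ z, k (r, y) (r - ρ, z) := by
        rw [lintegral_lintegral_swap]
        refine Measurable.aemeasurable ?_
        have : Measurable fun q : ((ℝ × ℝ) × (Fin n → ℝ)) × (Fin n → ℝ) =>
            k (q.1.1.1, q.1.2) (q.1.1.1 - q.1.1.2, q.2) :=
          hk.comp (f := fun q : ((ℝ × ℝ) × (Fin n → ℝ)) × (Fin n → ℝ) =>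
            ((q.1.1.1, q.1.2), (q.1.1.1 - q.1.1.2, q.2))) (by fun_prop)
        exact Measurable.mul (by fun_prop) this.lintegral_prod_right'.lintegral_prod_right'
    _ = ∫⁻ ρ, ENNReal.ofReal ρ ^ 2 * ∫⁻ r, ∫⁻ y, ∫⁻ z, k (r, y) (r - ρ, z) := by
        congr with ρ
        rw [lintegral_const_mul' _ _ (by simp)]
    _ = _ := by
        rw [← lintegral_indicator measurableSet_Ioi]
        congr with ρ
        by_cases h : 0 < ρ
        · rw [Set.indicator_of_mem (by exact h), ENNReal.ofReal_pow h.le]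
        · rw [Set.indicator_of_notMem (by exact h), ENNReal.ofReal_of_nonpos (not_lt.1 h)]
          simp

/-- Exchanging the transverse variables `y`, `z` in Lagrange's remainder gives the same product as
exchanging the `ω`-components of `a` and `b`, which is the collision. -/
lemma collision_identity {d : ℕ} (hd : d ≠ 0) {F : Space d → ℂ} (hF : Measurable F)
    (hF2 : ∫⁻ x, ‖F x‖ₑ ^ 2 < ∞) {ω : Space d} (hω : ‖ω‖ = 1)
    (hfin : ∫⁻ a, ∫⁻ b, ENNReal.ofReal (inner ℝ (a - b) ω) ^ 2 * (‖F a‖ₑ ^ 2 * ‖F b‖ₑ ^ 2) < ∞) :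
    (∫⁻ ρ in Set.Ioi (0 : ℝ), ENNReal.ofReal (ρ ^ 2) *
      ∫⁻ τ : ℝ, ‖∫ η, F η * conj (F (η - ρ • ω)) *
        cexp (I * ((-(2 * Real.pi) * τ * inner ℝ η ω : ℝ) : ℂ))‖ₑ ^ 2) +
      2⁻¹ * (∫⁻ a, ∫⁻ b, ENNReal.ofReal (inner ℝ (a - b) ω) ^ 2 *
        ‖F a * F b - F (collide ω a b) * F (collide ω b a)‖ₑ ^ 2)
      = ∫⁻ a, ∫⁻ b, ENNReal.ofReal (inner ℝ (a - b) ω) ^ 2 * (‖F a‖ₑ ^ 2 * ‖F b‖ₑ ^ 2) := by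
  obtain ⟨n, rfl⟩ := Nat.exists_eq_succ_of_ne_zero hd
  obtain ⟨Φ, hΦ, hΦ1, hΦ2⟩ := exists_coordinates hω
  set f : ℝ × (Fin n → ℝ) → ℂ := F ∘ Φ.symm with hf
  have hfm : Measurable f := hF.comp Φ.symm.measurable
  have hfF : ∀ x, F x = f (Φ x) := fun x => by simp [hf]
  have hcol : ∀ a b, Φ (collide ω a b) = ((Φ b).1, (Φ a).2) := by
    intro a b
    rw [collide, sub_eq_add_neg, ← neg_smul, hΦ2, inner_sub_left, ← hΦ1, ← hΦ1]
    congr 1; ring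
  have hf2 : ∫⁻ r, ∫⁻ y, ‖f (r, y)‖ₑ ^ 2 < ∞ := by
    rw [← lintegral_prod _ (hfm.enorm.pow_const 2).aemeasurable, ← Measure.volume_eq_prod,
      ← hΦ.lintegral_comp (hfm.enorm.pow_const 2)]
    simpa only [hfF] using hF2
  have hR := lintegral_lintegral_coordinates (ω := ω) hΦ hΦ1
    (k := fun p q => ‖f p‖ₑ ^ 2 * ‖f q‖ₑ ^ 2) (by unfold Function.uncurry; fun_prop)
  have hD := lintegral_lintegral_coordinates (ω := ω) hΦ hΦ1
    (k := fun p q => ‖f p * f q - f (q.1, p.2) * f (p.1, q.2)‖ₑ ^ 2)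
    (by unfold Function.uncurry; fun_prop)
  have hR' : ∀ ρ r : ℝ, ∫⁻ y, ∫⁻ z, ‖f (r, y)‖ₑ ^ 2 * ‖f (r - ρ, z)‖ₑ ^ 2
      = (∫⁻ y, ‖f (r, y)‖ₑ ^ 2) * ∫⁻ z, ‖f (r - ρ, z)‖ₑ ^ 2 := by
    intro ρ r
    have hm : ∀ s, Measurable fun y => ‖f (s, y)‖ₑ ^ 2 :=
      fun s => (hfm.comp measurable_prodMk_left).enorm.pow_const 2
    simp_rw [lintegral_const_mul _ (hm _)]
    rw [lintegral_mul_const _ (hm _)]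
  simp only [hR'] at hR
  simp_rw [hfF, hcol]
  simp_rw [hfF] at hfin
  rw [hR] at hfin ⊢
  rw [hD, ← strip_identity hfm hf2 hfin]
  congr 1
  · congr with ρ
    congr 1
    congr with τ
    congr 2
    have hmeas : ∀ η, Φ (η - ρ • ω) = ((Φ η).1 - ρ, (Φ η).2) := fun η => by
      rw [sub_eq_add_neg, ← neg_smul, hΦ2]; rfl
    simp_rw [hmeas, ← hΦ1]
    exact hΦ.integral_comp' (fun p : ℝ × (Fin n → ℝ) => f p * conj (f (p.1 - ρ, p.2)) *
      cexp (I * ((-(2 * Real.pi) * τ * p.1 : ℝ) : ℂ)))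
  · congr with ρ
    congr 1
    congr with r
    congr with y
    congr with z
    rw [mul_comm (f (r - ρ, y))]

/-! ### Polar coordinates and the average over directions -/

/-- The unit sphere of `ℝ^d`. -/
abbrev UnitSphere (d : ℕ) : Type := Metric.sphere (0 : Space d) 1

/-- The surface measure on the unit sphere. -/
abbrev sphereMeasure (d : ℕ) : Measure (UnitSphere d) := (volume : Measure (Space d)).toSphere

lemma lintegral_polar (hd : d ≠ 0) {g : Space d → ℝ≥0∞} (hg : Measurable g) :
    ∫⁻ x, g x = ∫⁻ ω : UnitSphere d, (∫⁻ ρ in Set.Ioi (0 : ℝ), ENNReal.ofReal (ρ ^ (d - 1)) *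
      g (ρ • (ω : Space d))) ∂sphereMeasure d := by
  have : Nontrivial (Space d) := by
    obtain ⟨n, rfl⟩ := Nat.exists_eq_succ_of_ne_zero hd
    infer_instance
  have hmul : Measurable fun q : UnitSphere d × Set.Ioi (0 : ℝ) =>
      g ((q.2 : ℝ) • (q.1 : Space d)) := by fun_prop
  have h0 : ∫⁻ x, g x = ∫⁻ x : ({0}ᶜ : Set (Space d)), g x.1
      ∂((volume : Measure (Space d)).comap Subtype.val) := by
    rw [lintegral_subtype_comap (measurableSet_singleton _).compl g, restrict_compl_singleton]
  rw [h0]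
  have h1 := (volume : Measure (Space d)).measurePreserving_homeomorphUnitSphereProd.lintegral_comp
    hmul
  have h2 : ∀ x : ({0}ᶜ : Set (Space d)), ((homeomorphUnitSphereProd (Space d) x).2 : ℝ) •
      ((homeomorphUnitSphereProd (Space d) x).1 : Space d) = x := by
    intro x
    have := (homeomorphUnitSphereProd (Space d)).symm_apply_apply x
    conv_rhs => rw [← this]
    rfl
  simp_rw [h2] at h1
  rw [h1, lintegral_prod _ hmul.aemeasurable]
  congr with ω
  rw [finrank_euclideanSpace_fin, Measure.volumeIoiPow, lintegral_withDensity_eq_lintegral_mul _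
    (by fun_prop) (by fun_prop)]
  exact lintegral_subtype_comap measurableSet_Ioi
    (fun r : ℝ => ENNReal.ofReal (r ^ (d - 1)) * g (r • (ω : Space d)))

/-- The second moment of the surface measure on a half sphere. -/
def halfMoment (p : Space d) : ℝ≥0∞ :=
  ∫⁻ ω : UnitSphere d, ENNReal.ofReal (inner ℝ p (ω : Space d)) ^ 2 ∂sphereMeasure d

/-- Passing to the ball lets the isometry invariance of Lebesgue measure replace that of the surface
measure. -/
lemma lintegral_ball_eq_halfMoment (hd : d ≠ 0) (p : Space d) :
    ∫⁻ x in Metric.ball (0 : Space d) 1, ENNReal.ofReal (inner ℝ p x) ^ 2 =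
      halfMoment p * ∫⁻ ρ in Set.Ioo (0 : ℝ) 1, ENNReal.ofReal (ρ ^ (d + 1)) := by
  rw [← lintegral_indicator measurableSet_ball, lintegral_polar hd
    (Measurable.indicator (by fun_prop) measurableSet_ball), halfMoment,
    ← lintegral_mul_const _ (by fun_prop)]
  congr with ω
  have hω : ‖(ω : Space d)‖ = 1 := by simp
  rw [← lintegral_const_mul _ (by fun_prop), ← lintegral_indicator measurableSet_Ioi,
    ← lintegral_indicator measurableSet_Ioo]
  congr with ρ
  by_cases h0 : 0 < ρ
  · rw [Set.indicator_of_mem (by exact h0)]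
    by_cases h1 : ρ < 1
    · rw [Set.indicator_of_mem (by simp [norm_smul, hω, abs_of_pos h0, h1]),
        Set.indicator_of_mem (by exact ⟨h0, h1⟩), inner_smul_right, ENNReal.ofReal_mul h0.le,
        mul_pow, ← ENNReal.ofReal_pow h0.le, ← mul_assoc, ← ENNReal.ofReal_mul (by positivity),
        ← pow_add, mul_comm, show d - 1 + 2 = d + 1 by omega]
    · rw [Set.indicator_of_notMem (by simp [norm_smul, hω, abs_of_pos h0]; linarith),
        Set.indicator_of_notMem (by simp; intro; linarith), mul_zero]
  · rw [Set.indicator_of_notMem (by exact h0), Set.indicator_of_notMem (by simp; intro; linarith)]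

lemma halfMoment_eq_of_norm_eq (hd : d ≠ 0) {p q : Space d} (h : ‖p‖ = ‖q‖) :
    halfMoment p = halfMoment q := by
  set k := ∫⁻ ρ in Set.Ioo (0 : ℝ) 1, ENNReal.ofReal (ρ ^ (d + 1)) with hk
  have hk0 : k ≠ 0 := by
    rw [hk, ← pos_iff_ne_zero, setLIntegral_pos_iff (by fun_prop)]
    have : Function.support (fun ρ : ℝ => ENNReal.ofReal (ρ ^ (d + 1))) ∩ Set.Ioo 0 1
        = Set.Ioo 0 1 := by
      rw [Set.inter_eq_right]
      intro ρ hρ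
      have : 0 < ρ := hρ.1
      simp only [Function.mem_support, ne_eq, ENNReal.ofReal_eq_zero, not_le]
      positivity
    rw [this]; simp
  have hk1 : k ≠ ∞ := by
    refine (lt_of_le_of_lt (setLIntegral_mono (g := fun _ => 1) measurable_const
      fun ρ hρ => ?_) (by simp : _ < ∞)).ne
    rw [ENNReal.ofReal_le_one]
    exact pow_le_one₀ hρ.1.le hρ.2.le
  -- The reflection exchanging two vectors of equal length.
  set R := (ℝ ∙ (p - q))ᗮ.reflection with hR
  have hRp : R p = q := Submodule.reflection_sub h
  have e : ∫⁻ x in Metric.ball (0 : Space d) 1, ENNReal.ofReal (inner ℝ p x) ^ 2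
      = ∫⁻ x in Metric.ball (0 : Space d) 1, ENNReal.ofReal (inner ℝ q x) ^ 2 := by
    have hmp : MeasurePreserving R volume volume := R.measurePreserving
    rw [← hmp.setLIntegral_comp_preimage measurableSet_ball (by fun_prop)]
    have hpre : R ⁻¹' Metric.ball 0 1 = Metric.ball 0 1 := by ext x; simp
    rw [hpre]
    congr with x
    rw [← R.inner_map_map p (R x), hRp, hR, Submodule.reflection_reflection]
  rw [lintegral_ball_eq_halfMoment hd, lintegral_ball_eq_halfMoment hd] at e
  exact (ENNReal.mul_left_inj hk0 hk1).1 e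

lemma halfMoment_smul (p : Space d) {c : ℝ} (hc : 0 ≤ c) :
    halfMoment (c • p) = ENNReal.ofReal (c ^ 2) * halfMoment p := by
  rw [halfMoment, halfMoment, ← lintegral_const_mul _ (by fun_prop)]
  congr with ω
  rw [real_inner_smul_left, ENNReal.ofReal_mul hc, mul_pow, ENNReal.ofReal_pow hc]

lemma ofReal_sq_add_ofReal_neg_sq (x : ℝ) :
    ENNReal.ofReal x ^ 2 + ENNReal.ofReal (-x) ^ 2 = ENNReal.ofReal (x ^ 2) := by
  rcases le_total 0 x with h | h
  · rw [ENNReal.ofReal_of_nonpos (neg_nonpos.2 h), ENNReal.ofReal_pow h]; simp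
  · rw [ENNReal.ofReal_of_nonpos h, ← ENNReal.ofReal_pow (neg_nonneg.2 h)]; simp

/-- All unit vectors have the same half moment. Over the `2d` vectors `±eᵢ` the integrands add up to
`|ω|² = 1`, so the total is the area `d |B|` of the sphere, and each half moment is `|B| / 2`. -/
lemma halfMoment_eq (hd : d ≠ 0) (p : Space d) :
    halfMoment p = ‖p‖ₑ ^ 2 * (2⁻¹ * volume (Metric.ball (0 : Space d) 1)) := by
  set b : Fin d → Space d := fun i => EuclideanSpace.single i 1 with hb
  have hb1 : ∀ i, ‖b i‖ = 1 := fun i => by simp [hb]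
  set i0 : Fin d := ⟨0, Nat.pos_of_ne_zero hd⟩
  have hsum : ∑ i, (halfMoment (b i) + halfMoment (-b i)) = sphereMeasure d Set.univ := by
    simp_rw [halfMoment]
    rw [Finset.sum_congr rfl fun i _ => (lintegral_add_left (by fun_prop) _).symm,
      ← lintegral_finsetSum _ fun i _ => by fun_prop, ← lintegral_one]
    congr with ω
    have hω : ‖(ω : Space d)‖ = 1 := by simp
    simp_rw [inner_neg_left, ofReal_sq_add_ofReal_neg_sq]
    rw [← ENNReal.ofReal_sum_of_nonneg fun i _ => by positivity]
    simp only [hb, EuclideanSpace.inner_single_left, map_one, one_mul]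
    rw [← EuclideanSpace.real_norm_sq_eq, hω]; simp
  have hall : ∀ v : Space d, ‖v‖ = 1 → halfMoment v = halfMoment (b i0) := fun v hv =>
    halfMoment_eq_of_norm_eq hd (hv.trans (hb1 i0).symm)
  have hval : halfMoment (b i0) = 2⁻¹ * volume (Metric.ball (0 : Space d) 1) := by
    rw [Finset.sum_congr rfl fun i _ => by rw [hall _ (hb1 i), hall (-b i) (by simp [hb1])],
      Finset.sum_const, Measure.toSphere_apply_univ, Finset.card_univ, Fintype.card_fin,
      finrank_euclideanSpace_fin, nsmul_eq_mul,
      ENNReal.mul_right_inj (by simpa using hd) (by simp), ← two_mul] at hsum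
    rw [← hsum, ← mul_assoc, ENNReal.inv_mul_cancel (by simp) (by simp), one_mul]
  have h1 : halfMoment p = halfMoment (‖p‖ • b i0) :=
    halfMoment_eq_of_norm_eq hd (by rw [norm_smul, hb1]; simp)
  rw [h1, halfMoment_smul _ (norm_nonneg p), hval, ENNReal.ofReal_pow (norm_nonneg p), ofReal_norm]

/-! ### Expanding the square of the distance -/

section Moments

variable {F : Space d → ℂ}

/-- The first moment of `|F|²`. -/
def firstMoment (F : Space d → ℂ) : Space d := ∫ x, ‖F x‖ ^ 2 • x

lemma integrable_moments (hF : Measurable F) (hF0 : ∫⁻ x, ‖F x‖ₑ ^ 2 < ∞)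
    (hF2 : ∫⁻ x, ‖x‖ₑ ^ 2 * ‖F x‖ₑ ^ 2 < ∞) :
    Integrable (fun x => ‖F x‖ ^ 2) ∧ Integrable (fun x => ‖F x‖ ^ 2 • x) ∧
      Integrable (fun x => ‖x‖ ^ 2 * ‖F x‖ ^ 2) := by
  have h0 : Integrable (fun x => ‖F x‖ ^ 2) := by
    refine ⟨by fun_prop, ?_⟩
    simpa [HasFiniteIntegral, enorm_pow] using hF0
  have h2 : Integrable (fun x => ‖x‖ ^ 2 * ‖F x‖ ^ 2) := by
    refine ⟨by fun_prop, ?_⟩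
    simpa [HasFiniteIntegral, enorm_pow, enorm_mul] using hF2
  refine ⟨h0, ?_, h2⟩
  refine (h0.add h2).mono' (by fun_prop) (ae_of_all _ fun x => ?_)
  rw [norm_smul, norm_pow, norm_norm, Pi.add_apply]
  nlinarith [sq_nonneg (‖x‖ - 1), sq_nonneg ‖F x‖, mul_nonneg (sq_nonneg (‖x‖ - 1))
    (sq_nonneg ‖F x‖), mul_nonneg (sq_nonneg (‖x‖)) (sq_nonneg ‖F x‖)]

/-- In `|a-b|² = |a|² + |b|² - 2 a·b` the cross term factors into the square of the first moment; it
stands on the left to avoid truncated subtraction. -/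
lemma lintegral_norm_sub_sq (hF : Measurable F) (hF0 : ∫⁻ x, ‖F x‖ₑ ^ 2 < ∞)
    (hF2 : ∫⁻ x, ‖x‖ₑ ^ 2 * ‖F x‖ₑ ^ 2 < ∞) :
    (∫⁻ a, ∫⁻ b, ‖a - b‖ₑ ^ 2 * (‖F a‖ₑ ^ 2 * ‖F b‖ₑ ^ 2)) + 2 * ‖firstMoment F‖ₑ ^ 2 =
      2 * ((∫⁻ x, ‖x‖ₑ ^ 2 * ‖F x‖ₑ ^ 2) * ∫⁻ x, ‖F x‖ₑ ^ 2) := by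
  obtain ⟨h0, h1, h2⟩ := integrable_moments hF hF0 hF2
  have e0 : ∫⁻ x, ‖F x‖ₑ ^ 2 = ENNReal.ofReal (∫ x, ‖F x‖ ^ 2) := by
    rw [ofReal_integral_eq_lintegral_ofReal h0 (ae_of_all _ fun y => by positivity)]
    congr with y
    rw [ENNReal.ofReal_pow (by positivity), ofReal_norm]
  have e2 : ∫⁻ x, ‖x‖ₑ ^ 2 * ‖F x‖ₑ ^ 2 = ENNReal.ofReal (∫ x, ‖x‖ ^ 2 * ‖F x‖ ^ 2) := by
    rw [ofReal_integral_eq_lintegral_ofReal h2 (ae_of_all _ fun y => by positivity)]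
    congr with y
    rw [ENNReal.ofReal_mul (by positivity), ENNReal.ofReal_pow (by positivity),
      ENNReal.ofReal_pow (by positivity), ofReal_norm, ofReal_norm]
  set A := ∫ x, ‖F x‖ ^ 2
  set B := ∫ x, ‖x‖ ^ 2 * ‖F x‖ ^ 2
  have i1 : Integrable (fun p : Space d × Space d => (‖p.1‖ ^ 2 * ‖F p.1‖ ^ 2) * ‖F p.2‖ ^ 2)
      (volume.prod volume) := h2.mul_prod h0
  have i2 : Integrable (fun p : Space d × Space d => ‖F p.1‖ ^ 2 * (‖p.2‖ ^ 2 * ‖F p.2‖ ^ 2))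
      (volume.prod volume) := h0.mul_prod h2
  have i3 : Integrable (fun p : Space d × Space d =>
      inner ℝ (‖F p.1‖ ^ 2 • p.1) (‖F p.2‖ ^ 2 • p.2)) (volume.prod volume) := by
    refine (h1.norm.mul_prod h1.norm).mono' (by fun_prop) (ae_of_all _ fun p => ?_)
    exact norm_inner_le_norm _ _
  have i12 : Integrable (fun p : Space d × Space d => (‖p.1‖ ^ 2 * ‖F p.1‖ ^ 2) * ‖F p.2‖ ^ 2 +
      ‖F p.1‖ ^ 2 * (‖p.2‖ ^ 2 * ‖F p.2‖ ^ 2)) (volume.prod volume) := i1.add i2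
  have i3' : Integrable (fun p : Space d × Space d =>
      2 * inner ℝ (‖F p.1‖ ^ 2 • p.1) (‖F p.2‖ ^ 2 • p.2)) (volume.prod volume) := i3.const_mul 2
  have hpt : ∀ p : Space d × Space d, ‖p.1 - p.2‖ ^ 2 * (‖F p.1‖ ^ 2 * ‖F p.2‖ ^ 2) =
      (‖p.1‖ ^ 2 * ‖F p.1‖ ^ 2) * ‖F p.2‖ ^ 2 + ‖F p.1‖ ^ 2 * (‖p.2‖ ^ 2 * ‖F p.2‖ ^ 2) -
      2 * inner ℝ (‖F p.1‖ ^ 2 • p.1) (‖F p.2‖ ^ 2 • p.2) := by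
    intro p
    rw [norm_sub_sq_real, real_inner_smul_left, real_inner_smul_right]
    ring
  have hI : Integrable (fun p : Space d × Space d =>
      ‖p.1 - p.2‖ ^ 2 * (‖F p.1‖ ^ 2 * ‖F p.2‖ ^ 2)) (volume.prod volume) := by
    simp_rw [hpt]
    exact i12.sub i3'
  have hval : ∫ p : Space d × Space d, ‖p.1 - p.2‖ ^ 2 * (‖F p.1‖ ^ 2 * ‖F p.2‖ ^ 2)
      ∂(volume.prod volume) = 2 * (B * A) - 2 * ‖firstMoment F‖ ^ 2 := by
    simp_rw [hpt]
    have h3 : ∫ p : Space d × Space d, inner ℝ (‖F p.1‖ ^ 2 • p.1) (‖F p.2‖ ^ 2 • p.2)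
        ∂(volume.prod volume) = ‖firstMoment F‖ ^ 2 := by
      rw [integral_prod _ i3, ← real_inner_self_eq_norm_sq]
      have : ∀ x : Space d, ∫ y : Space d, inner ℝ (‖F x‖ ^ 2 • x) (‖F y‖ ^ 2 • y)
          = inner ℝ (firstMoment F) (‖F x‖ ^ 2 • x) := fun x => by
        rw [integral_inner h1, real_inner_comm, firstMoment]
      simp_rw [this]
      rw [integral_inner h1, firstMoment]
    rw [integral_sub i12 i3', integral_add i1 i2, integral_const_mul, h3,
      integral_prod_mul (fun x : Space d => ‖x‖ ^ 2 * ‖F x‖ ^ 2) (fun x => ‖F x‖ ^ 2),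
      integral_prod_mul (fun x => ‖F x‖ ^ 2) (fun x : Space d => ‖x‖ ^ 2 * ‖F x‖ ^ 2)]
    ring
  have hnn : 0 ≤ 2 * (B * A) - 2 * ‖firstMoment F‖ ^ 2 := by
    rw [← hval]; exact integral_nonneg fun p => by positivity
  have hl : ∫⁻ a, ∫⁻ b, ‖a - b‖ₑ ^ 2 * (‖F a‖ₑ ^ 2 * ‖F b‖ₑ ^ 2)
      = ENNReal.ofReal (2 * (B * A) - 2 * ‖firstMoment F‖ ^ 2) := by
    rw [← hval, ofReal_integral_eq_lintegral_ofReal hI (ae_of_all _ fun p => by positivity),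
      lintegral_prod _ hI.1.aemeasurable.ennreal_ofReal]
    congr with a
    congr with b
    rw [ENNReal.ofReal_mul (by positivity), ENNReal.ofReal_mul (by positivity)]
    simp only [ENNReal.ofReal_pow (norm_nonneg _), ofReal_norm]
  have hB0 : 0 ≤ B := integral_nonneg fun y => by positivity
  have hA0 : 0 ≤ A := integral_nonneg fun y => by positivity
  have h2' : ∀ y, 2 * ENNReal.ofReal y = ENNReal.ofReal (2 * y) := fun y => by
    rw [ENNReal.ofReal_mul (by norm_num), ENNReal.ofReal_ofNat]
  rw [hl, e0, e2, ← ENNReal.ofReal_mul hB0, ← ofReal_norm, ← ENNReal.ofReal_pow (by positivity),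
    h2', h2', ← ENNReal.ofReal_add hnn (by positivity)]
  congr 1
  ring

end Moments

/-! ### The exact identity with its two defects, and the constant -/

/-- The space-time norm of `(-Δ)^{(4-d)/4} |u|²` in terms of the Fourier transform `F` of the
initial datum. -/
def spaceTimeIntegral (F : Space d → ℂ) : ℝ≥0∞ :=
  ∫⁻ t : ℝ, ∫⁻ ξ, ENNReal.ofReal ((2 * Real.pi * ‖ξ‖) ^ (4 - d : ℝ)) *
    ‖∫ η, F η * conj (F (η - ξ)) *
      cexp (I * ((-(8 * Real.pi ^ 2) * t * inner ℝ η ξ : ℝ) : ℂ))‖ₑ ^ 2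

/-- The defect in the Cauchy–Schwarz inequality: it vanishes if and only if `F ⊗ F` is invariant
under elastic collisions. -/
def collisionDefect (F : Space d → ℂ) : ℝ≥0∞ :=
  ∫⁻ ω : UnitSphere d, (∫⁻ a, ∫⁻ b, ENNReal.ofReal (inner ℝ (a - b) (ω : Space d)) ^ 2 *
    ‖F a * F b - F (collide (ω : Space d) a b) * F (collide (ω : Space d) b a)‖ₑ ^ 2)
    ∂sphereMeasure d

lemma measurable_defect {F : Space d → ℂ} (hF : Measurable F) :
    Measurable fun q : (UnitSphere d × Space d) × Space d =>
      ENNReal.ofReal (inner ℝ (q.1.2 - q.2) (q.1.1 : Space d)) ^ 2 *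
      ‖F q.1.2 * F q.2 - F (collide (q.1.1 : Space d) q.1.2 q.2) *
        F (collide (q.1.1 : Space d) q.2 q.1.2)‖ₑ ^ 2 := by
  have h1 : Measurable fun q : (UnitSphere d × Space d) × Space d =>
      collide (q.1.1 : Space d) q.1.2 q.2 :=
    measurable_collide (by fun_prop) (by fun_prop) (by fun_prop)
  have h2 : Measurable fun q : (UnitSphere d × Space d) × Space d =>
      collide (q.1.1 : Space d) q.2 q.1.2 :=
    measurable_collide (by fun_prop) (by fun_prop) (by fun_prop)
  have h3 := hF.comp h1
  have h4 := hF.comp h2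
  simp only [Function.comp_def] at h3 h4
  fun_prop

lemma lintegral_comp_mul_left {g : ℝ → ℝ≥0∞} (hg : Measurable g) {a : ℝ} (ha : 0 < a) :
    ∫⁻ t, g (a * t) = ENNReal.ofReal a⁻¹ * ∫⁻ t, g t := by
  rw [← lintegral_map hg (measurable_const_mul a), Real.map_volume_mul_left ha.ne',
    lintegral_smul_measure, abs_of_pos (by positivity), smul_eq_mul]

/-- The Jacobian and the symbol give `ρ^(d-1) ρ^(4-d) = ρ³`. The substitution `τ = 4πρt`, chosen to
reach the kernel `exp(-2πi τ r)`, takes away one power of `ρ` and leaves `1/(4π)`. -/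
lemma spaceTimeIntegral_eq_polar (hd : d ≠ 0) {F : Space d → ℂ} (hF : Measurable F) :
    spaceTimeIntegral F = ENNReal.ofReal ((2 * Real.pi) ^ (4 - d : ℝ) / (4 * Real.pi)) *
      ∫⁻ ω : UnitSphere d, (∫⁻ ρ in Set.Ioi (0 : ℝ), ENNReal.ofReal (ρ ^ 2) *
        ∫⁻ τ : ℝ, ‖∫ η, F η * conj (F (η - ρ • (ω : Space d))) *
          cexp (I * ((-(2 * Real.pi) * τ * inner ℝ η (ω : Space d) : ℝ) : ℂ))‖ₑ ^ 2)
        ∂sphereMeasure d := by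
  have hm : Measurable fun q : ℝ × Space d =>
      ‖∫ η, F η * conj (F (η - q.2)) *
        cexp (I * ((-(8 * Real.pi ^ 2) * q.1 * inner ℝ η q.2 : ℝ) : ℂ))‖ₑ ^ 2 := by
    have : StronglyMeasurable fun p : (ℝ × Space d) × Space d => F p.2 * conj (F (p.2 - p.1.2)) *
        cexp (I * ((-(8 * Real.pi ^ 2) * p.1.1 * inner ℝ p.2 p.1.2 : ℝ) : ℂ)) := by
      refine Measurable.stronglyMeasurable ?_
      have hc := Complex.measurable_ofReal
      have hconj : Measurable conj := Complex.continuous_conj.measurable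
      have h1 := hconj.comp (hF.comp (f := fun p : (ℝ × Space d) × Space d => p.2 - p.1.2)
        (by fun_prop))
      simp only [Function.comp_def] at h1
      fun_prop
    exact (this.integral_prod_right').measurable.enorm.pow_const 2
  have hw : Measurable fun ξ : Space d =>
      ENNReal.ofReal ((2 * Real.pi * ‖ξ‖) ^ (4 - d : ℝ)) := by fun_prop
  have hm2 : Measurable fun q : ℝ × Space d =>
      ENNReal.ofReal ((2 * Real.pi * ‖q.2‖) ^ (4 - d : ℝ)) *
      ‖∫ η, F η * conj (F (η - q.2)) *
        cexp (I * ((-(8 * Real.pi ^ 2) * q.1 * inner ℝ η q.2 : ℝ) : ℂ))‖ₑ ^ 2 :=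
    (hw.comp measurable_snd).mul hm
  rw [spaceTimeIntegral, lintegral_lintegral_swap hm2.aemeasurable,
    lintegral_polar hd hm2.lintegral_prod_left', ← lintegral_const_mul' _ _ ENNReal.ofReal_ne_top]
  congr with ω
  have hω : ‖(ω : Space d)‖ = 1 := by simp
  rw [← lintegral_const_mul' _ _ ENNReal.ofReal_ne_top]
  refine setLIntegral_congr_fun measurableSet_Ioi fun ρ hρ => ?_
  have hρ : 0 < ρ := hρ
  have e : ∀ t : ℝ, ‖∫ η, F η * conj (F (η - ρ • (ω : Space d))) *
        cexp (I * ((-(8 * Real.pi ^ 2) * t * inner ℝ η (ρ • (ω : Space d)) : ℝ) : ℂ))‖ₑ ^ 2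
      = ‖∫ η, F η * conj (F (η - ρ • (ω : Space d))) *
      cexp (I * ((-(2 * Real.pi) * ((4 * Real.pi * ρ) * t) * inner ℝ η (ω : Space d) : ℝ) : ℂ))‖ₑ
        ^ 2 := by
    intro t
    congr 3 with η
    congr 4
    rw [inner_smul_right]
    ring
  have hB : Measurable fun τ : ℝ => ‖∫ η, F η * conj (F (η - ρ • (ω : Space d))) *
      cexp (I * ((-(2 * Real.pi) * τ * inner ℝ η (ω : Space d) : ℝ) : ℂ))‖ₑ ^ 2 := by
    have h := hm.comp (f := fun τ : ℝ => ((4 * Real.pi * ρ)⁻¹ * τ, ρ • (ω : Space d)))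
      (by fun_prop)
    simp only [Function.comp_def, e] at h
    simpa only [mul_inv_cancel_left₀ (show 4 * Real.pi * ρ ≠ 0 by positivity)] using h
  dsimp only
  rw [lintegral_const_mul' _ _ ENNReal.ofReal_ne_top]
  simp_rw [e]
  rw [lintegral_comp_mul_left hB (by positivity), ← mul_assoc, ← mul_assoc, ← mul_assoc]
  congr 1
  rw [← ENNReal.ofReal_mul (by positivity), ← ENNReal.ofReal_mul (by positivity),
    ← ENNReal.ofReal_mul (by positivity)]
  congr 1
  rw [norm_smul, hω, mul_one, Real.norm_of_nonneg hρ.le,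
    Real.mul_rpow (by positivity) hρ.le]
  have hpow : ρ ^ (d - 1) * ρ ^ (4 - d : ℝ) = ρ ^ 3 := by
    rw [← Real.rpow_natCast, ← Real.rpow_add hρ, ← Real.rpow_natCast, Nat.cast_sub (by omega)]
    congr 1; push_cast; ring
  have : ρ ^ (d - 1) * ((2 * Real.pi) ^ (4 - d : ℝ) * ρ ^ (4 - d : ℝ)) =
      (2 * Real.pi) ^ (4 - d : ℝ) * ρ ^ 3 := by rw [← hpow]; ring
  rw [this]
  field_simp

/-- The space-time norm plus its two defects equals the right-hand side of the estimate. -/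
theorem spaceTimeIntegral_add_defects (hd : d ≠ 0) {F : Space d → ℂ} (hF : Measurable F)
    (hF0 : ∫⁻ x, ‖F x‖ₑ ^ 2 < ∞) (hF2 : ∫⁻ x, ‖x‖ₑ ^ 2 * ‖F x‖ₑ ^ 2 < ∞) :
    spaceTimeIntegral F + ENNReal.ofReal ((2 * Real.pi) ^ (4 - d : ℝ) / (4 * Real.pi)) *
      (2⁻¹ * collisionDefect F + volume (Metric.ball (0 : Space d) 1) * ‖firstMoment F‖ₑ ^ 2) =
    ENNReal.ofReal ((2 * Real.pi) ^ (4 - d : ℝ) / (4 * Real.pi)) *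
      (volume (Metric.ball (0 : Space d) 1) *
        ((∫⁻ x, ‖x‖ₑ ^ 2 * ‖F x‖ₑ ^ 2) * ∫⁻ x, ‖F x‖ₑ ^ 2)) := by
  set V := volume (Metric.ball (0 : Space d) 1)
  have hmom := lintegral_norm_sub_sq hF hF0 hF2
  have hle : ∫⁻ a, ∫⁻ b, ‖a - b‖ₑ ^ 2 * (‖F a‖ₑ ^ 2 * ‖F b‖ₑ ^ 2) < ∞ := by
    refine lt_of_le_of_lt (le_self_add.trans hmom.le) ?_
    exact ENNReal.mul_lt_top (by simp) (ENNReal.mul_lt_top hF2 hF0)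
  have hid : ∀ ω : UnitSphere d, _ := fun ω => collision_identity hd hF hF0
    (ω := (ω : Space d)) (by simp) (by
      refine lt_of_le_of_lt ?_ hle
      refine lintegral_mono fun a => lintegral_mono fun b => ?_
      gcongr
      rw [← ofReal_norm]
      refine ENNReal.ofReal_le_ofReal ((real_inner_le_norm _ _).trans ?_)
      simp)
  have hmR : Measurable fun q : (UnitSphere d × Space d) × Space d =>
      ENNReal.ofReal (inner ℝ (q.1.2 - q.2) (q.1.1 : Space d)) ^ 2 *
        (‖F q.1.2‖ₑ ^ 2 * ‖F q.2‖ₑ ^ 2) := by fun_prop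
  have hsphere : ∫⁻ ω : UnitSphere d, (∫⁻ a, ∫⁻ b,
      ENNReal.ofReal (inner ℝ (a - b) (ω : Space d)) ^ 2
      * (‖F a‖ₑ ^ 2 * ‖F b‖ₑ ^ 2)) ∂sphereMeasure d
      = 2⁻¹ * V * ∫⁻ a, ∫⁻ b, ‖a - b‖ₑ ^ 2 * (‖F a‖ₑ ^ 2 * ‖F b‖ₑ ^ 2) := by
    rw [lintegral_lintegral_swap hmR.lintegral_prod_right'.aemeasurable,
      ← lintegral_const_mul _ (Measurable.lintegral_prod_right' (f := fun q : Space d × Space d =>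
        ‖q.1 - q.2‖ₑ ^ 2 * (‖F q.1‖ₑ ^ 2 * ‖F q.2‖ₑ ^ 2)) (by fun_prop))]
    congr with a
    have hmR' : Measurable (Function.uncurry fun (ω : UnitSphere d) (b : Space d) =>
        ENNReal.ofReal (inner ℝ (a - b) (ω : Space d)) ^ 2 * (‖F a‖ₑ ^ 2 * ‖F b‖ₑ ^ 2)) := by
      unfold Function.uncurry; fun_prop
    rw [lintegral_lintegral_swap hmR'.aemeasurable,
      ← lintegral_const_mul _ (by fun_prop)]
    congr with b
    rw [lintegral_mul_const _ (by fun_prop), ← halfMoment, halfMoment_eq hd]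
    ring
  have hsum := lintegral_congr (μ := sphereMeasure d) hid
  rw [lintegral_add_right _
    ((measurable_defect hF).lintegral_prod_right'.lintegral_prod_right'.const_mul _),
    lintegral_const_mul _ (measurable_defect hF).lintegral_prod_right'.lintegral_prod_right',
    hsphere] at hsum
  rw [spaceTimeIntegral_eq_polar hd hF, ← mul_add, ← add_assoc]
  congr 1
  rw [collisionDefect, hsum]
  have h2 : V * ‖firstMoment F‖ₑ ^ 2 = 2⁻¹ * V * (2 * ‖firstMoment F‖ₑ ^ 2) := by
    rw [mul_comm 2⁻¹ V, mul_assoc V, ← mul_assoc 2⁻¹,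
      ENNReal.inv_mul_cancel (by simp) (by simp), one_mul]
  rw [h2, ← mul_add, hmom, mul_comm 2⁻¹ V, mul_assoc V, ← mul_assoc 2⁻¹,
    ENNReal.inv_mul_cancel (by simp) (by simp), one_mul]

/-- Uses `|B| = π^(d/2) / Γ(d/2+1)`. The extra `(2π)²` on the right is the one in the `Ḣ¹` norm for
the kernel `exp(-2πi x·ξ)`. -/
lemma ofReal_mul_volume_ball (hd : d ≠ 0) :
    ENNReal.ofReal ((2 * Real.pi) ^ (4 - d : ℝ) / (4 * Real.pi)) *
      volume (Metric.ball (0 : Space d) 1) =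
    ENNReal.ofReal (sharpConstant d) * ENNReal.ofReal ((2 * Real.pi) ^ 2) := by
  have : Nonempty (Fin d) := ⟨⟨0, Nat.pos_of_ne_zero hd⟩⟩
  have hG : 0 < Real.Gamma ((d : ℝ) / 2 + 1) := Real.Gamma_pos_of_pos (by positivity)
  rw [EuclideanSpace.volume_ball, Fintype.card_fin, ENNReal.ofReal_one, one_pow, one_mul,
    ← ENNReal.ofReal_mul (by positivity), sharpConstant, ← ENNReal.ofReal_mul
    (by rw [show ((d : ℝ) + 2) / 2 = d / 2 + 1 by ring]; positivity),
    show ((d : ℝ) + 2) / 2 = d / 2 + 1 by ring]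
  congr 1
  have hpi := Real.pi_pos
  have e1 : (2 * Real.pi) ^ (4 - d : ℝ) = 2 ^ (-(d : ℝ)) * 16 * (Real.pi ^ 4 * Real.pi ^ (-(d:ℝ)))
      := by
    rw [Real.mul_rpow (by norm_num) hpi.le, sub_eq_add_neg, Real.rpow_add (by norm_num),
      Real.rpow_add hpi]
    norm_num
    ring
  have e2 : √Real.pi ^ d = Real.pi ^ ((d : ℝ) / 2) := by
    rw [Real.sqrt_eq_rpow, ← Real.rpow_natCast, ← Real.rpow_mul hpi.le]
    congr 1; ring
  have e3 : Real.pi ^ ((2 - d : ℝ) / 2) = Real.pi * Real.pi ^ ((d : ℝ) / 2) *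
      Real.pi ^ (-(d : ℝ)) := by
    nth_rewrite 2 [← Real.rpow_one Real.pi]
    rw [← Real.rpow_add hpi, ← Real.rpow_add hpi]
    congr 1; ring
  rw [e1, e2, e3]
  field_simp
  ring

/-! ### The functional equation of collision invariants -/

/-- Integrating the equation in `t` over `[0, δ]` gives `C(s+δ) - C(s) = g(s) C(δ)`, so `g` is
differentiable for `s ≥ 0` and satisfies `g' = κ g` there. Only the half line is assumed because the
parameter will be a squared length. -/
lemma exists_exp_of_add_eq_mul_of_nonneg {g : ℝ → ℂ} (hg : Continuous g) (h0 : g 0 = 1)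
    (hmul : ∀ s t, 0 ≤ s → 0 ≤ t → g (s + t) = g s * g t) :
    ∃ κ : ℂ, ∀ s, 0 ≤ s → g s = cexp (κ * s) := by
  set C : ℝ → ℂ := fun x => ∫ t in (0 : ℝ)..x, g t with hC
  have hCd : ∀ x, HasDerivAt C (g x) x := fun x =>
    intervalIntegral.integral_hasDerivAt_right (hg.intervalIntegrable _ _)
      (hg.stronglyMeasurableAtFilter _ _) hg.continuousAt
  obtain ⟨δ, hδ, hδ0⟩ : ∃ δ : ℝ, C δ ≠ 0 ∧ 0 < δ := by
    have h1 : ∀ᶠ z in 𝓝[≠] (0 : ℝ), C z ≠ 0 := (hCd 0).eventually_ne (by simp [h0])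
    have h2 : ∀ᶠ z in 𝓝[>] (0 : ℝ), C z ≠ 0 :=
      h1.filter_mono (nhdsWithin_mono _ fun x hx => ne_of_gt hx)
    exact (h2.and self_mem_nhdsWithin).exists
  have hP : ∀ s, 0 ≤ s → C (s + δ) - C s = g s * C δ := by
    intro s hs
    rw [hC]
    dsimp only
    rw [intervalIntegral.integral_interval_sub_left (hg.intervalIntegrable _ _)
      (hg.intervalIntegrable _ _), ← intervalIntegral.integral_const_mul]
    have := intervalIntegral.integral_comp_add_left (a := 0) (b := δ) g s
    rw [add_zero] at this
    rw [← this]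
    refine intervalIntegral.integral_congr fun t ht => ?_
    rw [Set.uIcc_of_le hδ0.le] at ht
    exact hmul s t hs ht.1
  set κ : ℂ := (g δ - 1) / C δ with hκ
  refine ⟨κ, fun s hs => ?_⟩
  set Q : ℝ → ℂ := fun s => (C (s + δ) - C s) * cexp (-(κ * s)) with hQ
  have hQd : ∀ s, 0 ≤ s → HasDerivAt Q 0 s := by
    intro s hs
    have h1 : HasDerivAt (fun s => C (s + δ) - C s) (g (s + δ) - g s) s :=
      ((hCd (s + δ)).comp_add_const s δ).sub (hCd s)
    have h2 : HasDerivAt (fun s : ℝ => cexp (-(κ * s))) (cexp (-(κ * s)) * (-(κ * 1))) s :=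
      ((hasDerivAt_id s).ofReal_comp.const_mul κ).neg.cexp
    refine (h1.mul h2).congr_deriv ?_
    rw [hP s hs, hmul s δ hs hδ0.le, hκ]
    field_simp
    ring
  have hconst := constant_of_has_deriv_right_zero (a := 0) (b := s) (f := Q)
    (fun x hx => (hQd x hx.1).continuousAt.continuousWithinAt)
    (fun x hx => (hQd x hx.1).hasDerivWithinAt) s ⟨hs, le_rfl⟩
  simp only [hQ] at hconst
  rw [hP s hs, hP 0 le_rfl, h0, ofReal_zero, mul_zero, neg_zero, Complex.exp_zero, one_mul,
    mul_one, Complex.exp_neg, ← div_eq_mul_inv, div_eq_iff (Complex.exp_ne_zero _),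
    mul_comm (g s)] at hconst
  exact mul_left_cancel₀ hδ hconst

lemma exists_exp_of_add_eq_mul {g : ℝ → ℂ} (hg : Continuous g) (h0 : g 0 = 1)
    (hmul : ∀ s t, g (s + t) = g s * g t) : ∃ κ : ℂ, ∀ s, g s = cexp (κ * s) := by
  obtain ⟨κ, hκ⟩ := exists_exp_of_add_eq_mul_of_nonneg hg h0 fun s t _ _ => hmul s t
  refine ⟨κ, fun s => ?_⟩
  rcases le_total 0 s with hs | hs
  · exact hκ s hs
  · have h1 := hmul s (-s)
    rw [add_neg_cancel, h0, hκ (-s) (by linarith)] at h1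
    have h2 : cexp (κ * s) * cexp (κ * ((-s : ℝ) : ℂ)) = 1 := by
      rw [← Complex.exp_add]; simp
    exact mul_right_cancel₀ (Complex.exp_ne_zero _) (h1.symm.trans h2.symm)

/-- This is where dimension at least two enters. -/
lemma exists_orthogonal (hd : 2 ≤ d) (x : Space d) {r : ℝ} (hr : 0 ≤ r) :
    ∃ y : Space d, inner ℝ x y = 0 ∧ ‖y‖ = r := by
  have hne : (ℝ ∙ x)ᗮ ≠ ⊥ := by
    intro h
    have h1 := Submodule.finrank_add_finrank_orthogonal (ℝ ∙ x)
    rw [h, finrank_bot, finrank_euclideanSpace_fin] at h1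
    have h2 := finrank_span_le_card (R := ℝ) ({x} : Set (Space d))
    simp at h2
    omega
  obtain ⟨z, hz, hz0⟩ := Submodule.exists_mem_ne_zero_of_ne_bot hne
  rw [Submodule.mem_orthogonal_singleton_iff_inner_right] at hz
  refine ⟨(r / ‖z‖) • z, by rw [inner_smul_right, hz, mul_zero], ?_⟩
  rw [norm_smul, Real.norm_of_nonneg (by positivity), div_mul_cancel₀ _ (norm_ne_zero_iff.2 hz0)]

/-- `g(a) g(b)` depends only on the centre and the length of the segment `[a, b]`. -/
def IsCollisionInvariant (g : Space d → ℂ) : Prop :=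
  ∀ m p q : Space d, ‖p‖ = ‖q‖ → g (m + p) * g (m - p) = g (m + q) * g (m - q)

/-- The diagonals of a rectangle share centre and length, so `h` is multiplicative on orthogonal
pairs. The even part `e(x) = h(x)h(-x)` is radial, and by Pythagoras multiplicative in `|x|²`, hence
`exp(κ|x|²)`; in particular `h` has no zeros. The odd part `o(x) = h(x)/h(-x)` is a continuous
character, hence the exponential of a linear form. Finally `h(x) = o(x/2) e(x/2)²`. -/
lemma IsCollisionInvariant.exists_exp_of_map_zero (hd : 2 ≤ d) {h : Space d → ℂ}
    (hc : Continuous h) (hinv : IsCollisionInvariant h) (h0 : h 0 = 1) :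
    ∃ (κ : ℂ) (β : Fin d → ℂ), ∀ x, h x = cexp (κ * (‖x‖ ^ 2 : ℝ) + ∑ i, β i * x i) := by
  have horth : ∀ x y, inner ℝ x y = 0 → h (x + y) = h x * h y := by
    intro x y hxy
    have := hinv ((2⁻¹ : ℝ) • (x + y)) ((2⁻¹ : ℝ) • (x + y)) ((2⁻¹ : ℝ) • (x - y)) (by
      rw [norm_smul, norm_smul, ← sq_eq_sq₀ (by positivity) (by positivity), mul_pow, mul_pow,
        norm_add_sq_real, norm_sub_sq_real, hxy]
      ring)
    rw [sub_self, h0, mul_one, ← smul_add, ← smul_add, ← smul_sub] at this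
    convert this using 2
    · module
    · congr 1; module
    · congr 1; module
  set e : Space d → ℂ := fun x => h x * h (-x) with he
  have her : ∀ p q, ‖p‖ = ‖q‖ → e p = e q := fun p q hpq => by
    simpa [he] using hinv 0 p q hpq
  have heorth : ∀ x y, inner ℝ x y = 0 → e (x + y) = e x * e y := by
    intro x y hxy
    simp only [he]
    rw [neg_add, horth x y hxy, horth (-x) (-y) (by simpa using hxy)]
    ring
  obtain ⟨v, -, hv⟩ := exists_orthogonal hd (0 : Space d) zero_le_one
  obtain ⟨v', hvv', hv'⟩ := exists_orthogonal hd v zero_le_one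
  obtain ⟨κ, hκ⟩ : ∃ κ : ℂ, ∀ s : ℝ, 0 ≤ s → e (√s • v) = cexp (κ * s) := by
    refine exists_exp_of_add_eq_mul_of_nonneg (g := fun s => e (√s • v)) ?_ ?_ ?_
    · simp only [he]; fun_prop
    · simp [he, h0]
    · intro s t hs ht
      have h1 : e (√(s + t) • v) = e (√s • v + √t • v') := by
        apply her
        rw [← sq_eq_sq₀ (norm_nonneg _) (norm_nonneg _), norm_add_sq_real, real_inner_smul_left,
          real_inner_smul_right, hvv']
        simp only [norm_smul, hv, hv', Real.norm_of_nonneg (Real.sqrt_nonneg _), mul_one]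
        rw [Real.sq_sqrt hs, Real.sq_sqrt ht, Real.sq_sqrt (add_nonneg hs ht)]
        ring
      have h2 : e (√t • v') = e (√t • v) := her _ _ (by rw [norm_smul, norm_smul, hv, hv'])
      rw [h1, heorth _ _ (by rw [real_inner_smul_left, real_inner_smul_right, hvv']; simp), h2]
  have heκ : ∀ x, e x = cexp (κ * (‖x‖ ^ 2 : ℝ)) := by
    intro x
    rw [← hκ _ (sq_nonneg _)]
    apply her
    rw [norm_smul, hv, Real.sqrt_sq (norm_nonneg _)]; simp
  have hne : ∀ x, h x ≠ 0 := by
    intro x hx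
    have := heκ x
    simp only [he, hx, zero_mul] at this
    exact Complex.exp_ne_zero _ this.symm
  -- Rotate `p` to be orthogonal to `m`; then both factors split.
  have hpar : ∀ m p, h (m + p) * h (m - p) = h m ^ 2 * e p := by
    intro m p
    obtain ⟨p', hp', hpn⟩ := exists_orthogonal hd m (norm_nonneg p)
    rw [hinv m p p' hpn.symm, sub_eq_add_neg, horth m p' hp', horth m (-p') (by simpa using hp'),
      her p p' hpn.symm]
    simp only [he]; ring
  have hen : ∀ x, e (-x) = e x := fun x => her _ _ (norm_neg x)
  have hdouble : ∀ m, h (m + m) = h m ^ 2 * e m := by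
    intro m
    have := hpar m m
    rwa [sub_self, h0, mul_one] at this
  set o : Space d → ℂ := fun x => h x / h (-x) with ho
  have ho_add : ∀ x y, o (x + y) = o x * o y := by
    intro x y
    have e1 : h x * h y = h ((2⁻¹ : ℝ) • (x + y)) ^ 2 * e ((2⁻¹ : ℝ) • (x - y)) := by
      rw [← hpar, ← smul_add, ← smul_sub]
      congr 2 <;> module
    have e2 : h (-x) * h (-y) = h (-((2⁻¹ : ℝ) • (x + y))) ^ 2 * e ((2⁻¹ : ℝ) • (x - y)) := by
      rw [← hen ((2⁻¹ : ℝ) • (x - y)), ← hpar]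
      congr 2 <;> module
    have e3 : h (x + y) = h ((2⁻¹ : ℝ) • (x + y)) ^ 2 * e ((2⁻¹ : ℝ) • (x + y)) := by
      rw [← hdouble]; congr 1; module
    have e4 : h (-(x + y)) = h (-((2⁻¹ : ℝ) • (x + y))) ^ 2 * e ((2⁻¹ : ℝ) • (x + y)) := by
      rw [← hen ((2⁻¹ : ℝ) • (x + y)), ← hdouble]; congr 1; module
    have n1 : ∀ x, e x ≠ 0 := fun x => mul_ne_zero (hne _) (hne _)
    simp only [ho]
    rw [div_mul_div_comm, e1, e2, e3, e4, mul_div_mul_right _ _ (n1 _),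
      mul_div_mul_right _ _ (n1 _)]
  have ho0 : o 0 = 1 := by simp [ho, h0]
  have hoc : Continuous o := hc.div (by fun_prop) fun x => hne _
  have hβ : ∀ i : Fin d, ∃ β : ℂ, ∀ t : ℝ,
      o (t • EuclideanSpace.single i (1 : ℝ)) = cexp (β * t) := fun i =>
    exists_exp_of_add_eq_mul (g := fun t => o (t • EuclideanSpace.single i (1 : ℝ)))
      (by fun_prop) (by simp [ho0]) fun s t => by rw [add_smul, ho_add]
  choose β hβ using hβ
  have hosum : ∀ (s : Finset (Fin d)) (y : Fin d → Space d),
      o (∑ i ∈ s, y i) = ∏ i ∈ s, o (y i) := by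
    intro s y
    induction s using Finset.induction_on with
    | empty => simp [ho0]
    | insert a s ha ih => rw [Finset.sum_insert ha, Finset.prod_insert ha, ho_add, ih]
  have hoexp : ∀ x : Space d, o x = cexp (∑ i, β i * x i) := by
    intro x
    have hx : x = ∑ i, x i • EuclideanSpace.single i (1 : ℝ) := by
      have := (EuclideanSpace.basisFun (Fin d) ℝ).sum_repr x
      simpa using this.symm
    conv_lhs => rw [hx]
    rw [hosum, Complex.exp_sum]
    exact Finset.prod_congr rfl fun i _ => hβ i _
  refine ⟨κ / 2, fun i => β i / 2, fun x => ?_⟩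
  have h1 : h x = o ((2⁻¹ : ℝ) • x) * e ((2⁻¹ : ℝ) • x) ^ 2 := by
    have : h x = h ((2⁻¹ : ℝ) • x) ^ 2 * e ((2⁻¹ : ℝ) • x) := by
      rw [← hdouble]; congr 1; module
    rw [this]
    simp only [ho, he]
    field_simp [hne]
  rw [h1, hoexp, heκ, ← Complex.exp_nat_mul, ← Complex.exp_add]
  congr 1
  rw [norm_smul, add_comm]
  congr 1
  · norm_num; ring
  · refine Finset.sum_congr rfl fun i _ => ?_
    simp; ring

/-- The equation is translation invariant, so one nonzero value can be moved to the origin and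
normalised to `1`. -/
lemma IsCollisionInvariant.exists_exp (hd : 2 ≤ d) {g : Space d → ℂ}
    (hc : Continuous g) (hinv : IsCollisionInvariant g) {x₀ : Space d} (hx₀ : g x₀ ≠ 0) :
    ∃ (κ : ℂ) (β : Fin d → ℂ) (c : ℂ),
      ∀ x, g x = cexp (κ * (‖x‖ ^ 2 : ℝ) + ∑ i, β i * x i + c) := by
  obtain ⟨κ, β, h⟩ := IsCollisionInvariant.exists_exp_of_map_zero hd
    (h := fun x => g (x₀ + x) / g x₀) (by fun_prop) (fun m p q hpq => by
      have := hinv (x₀ + m) p q hpq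
      simp only [← add_assoc, ← add_sub_assoc] at this ⊢
      rw [div_mul_div_comm, this, div_mul_div_comm]) (by simp [hx₀])
  refine ⟨κ, fun i => β i - 2 * κ * x₀ i,
    κ * (‖x₀‖ ^ 2 : ℝ) - ∑ i, β i * x₀ i + Complex.log (g x₀), fun x => ?_⟩
  have h1 := h (x - x₀)
  rw [add_sub_cancel, div_eq_iff hx₀] at h1
  rw [h1]
  conv_lhs => rw [← Complex.exp_log hx₀]
  rw [← Complex.exp_add]
  congr 1
  have h2 : ((‖x - x₀‖ ^ 2 : ℝ) : ℂ) =
      (‖x‖ ^ 2 : ℝ) - 2 * ∑ i, (x₀ i : ℂ) * x i + (‖x₀‖ ^ 2 : ℝ) := by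
    rw [norm_sub_sq_real, PiLp.inner_apply]
    push_cast
    simp
  rw [h2]
  simp only [PiLp.sub_apply, ofReal_sub, mul_sub, sub_mul, Finset.sum_sub_distrib]
  have h3 : ∑ i, 2 * κ * (x₀ i : ℂ) * x i = 2 * κ * ∑ i, (x₀ i : ℂ) * x i := by
    rw [Finset.mul_sum]
    exact Finset.sum_congr rfl fun i _ => by ring
  linear_combination h3

/-! ### From a vanishing defect to a pointwise functional equation -/

/-- The elastic collision in the direction `ω`, as a linear map on pairs. -/
def collisionMap (ω : Space d) : Space d × Space d →ₗ[ℝ] Space d × Space d where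
  toFun p := (collide ω p.1 p.2, collide ω p.2 p.1)
  map_add' p q := by
    ext1
    · simp only [collide, Prod.fst_add, Prod.snd_add, inner_sub_left, inner_add_left]; module
    · simp only [collide, Prod.fst_add, Prod.snd_add, inner_sub_left, inner_add_left]; module
  map_smul' r p := by
    ext1
    · simp only [collide, Prod.smul_fst, Prod.smul_snd, inner_sub_left, real_inner_smul_left,
        RingHom.id_apply]
      module
    · simp only [collide, Prod.smul_fst, Prod.smul_snd, inner_sub_left, real_inner_smul_left,
        RingHom.id_apply]
      module

lemma collide_collide {ω : Space d} (hω : ‖ω‖ = 1) (a b : Space d) :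
    collide ω (collide ω a b) (collide ω b a) = a := by
  have h1 : inner ℝ ω ω = (1 : ℝ) := by rw [real_inner_self_eq_norm_sq, hω]; norm_num
  simp only [collide, inner_sub_left, real_inner_smul_left, h1]
  module

lemma norm_collide_sq_add {ω : Space d} (hω : ‖ω‖ = 1) (a b : Space d) :
    ‖collide ω a b‖ ^ 2 + ‖collide ω b a‖ ^ 2 = ‖a‖ ^ 2 + ‖b‖ ^ 2 := by
  simp only [collide, norm_sub_sq_real, norm_smul, hω, inner_sub_left, real_inner_smul_right,
    mul_pow, Real.norm_eq_abs, sq_abs]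
  ring

/-- The collision is self-adjoint on pairs, hence can be moved from the space to the frequency
variables. -/
lemma inner_collide_add (ω a b x y : Space d) :
    inner ℝ (collide ω a b) x + inner ℝ (collide ω b a) y =
      (inner ℝ a (collide ω x y) + inner ℝ b (collide ω y x) : ℝ) := by
  simp only [collide, inner_sub_left, inner_sub_right, real_inner_smul_left,
    real_inner_smul_right, real_inner_comm ω]
  ring

/-- The map is an involution, so its determinant squares to `1`. -/
lemma measurePreserving_collisionMap {ω : Space d} (hω : ‖ω‖ = 1) :
    MeasurePreserving (collisionMap ω) := by
  have hsq : (collisionMap ω) ∘ₗ (collisionMap ω) = LinearMap.id := by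
    refine LinearMap.ext fun p => ?_
    ext1
    · exact collide_collide hω _ _
    · exact collide_collide hω _ _
  have hdet : LinearMap.det (collisionMap ω) * LinearMap.det (collisionMap ω) = 1 := by
    rw [← LinearMap.det_comp, hsq, LinearMap.det_id]
  refine ⟨(collisionMap ω).continuous_of_finiteDimensional.measurable, ?_⟩
  have h0 : LinearMap.det (collisionMap ω) ≠ 0 := fun h => by simp [h] at hdet
  have h1 : |LinearMap.det (collisionMap ω)| = 1 := by
    have := abs_mul_abs_self (LinearMap.det (collisionMap ω))
    rw [hdet] at this
    nlinarith [abs_nonneg (LinearMap.det (collisionMap ω))]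
  have : (volume : Measure (Space d × Space d)).IsAddHaarMeasure :=
    inferInstanceAs
      ((volume : Measure (Space d)).prod (volume : Measure (Space d))).IsAddHaarMeasure
  rw [Measure.map_linearMap_addHaar_eq_smul_addHaar _ h0, abs_inv, h1]
  simp

lemma measurableEmbedding_collisionMap {ω : Space d} (hω : ‖ω‖ = 1) :
    MeasurableEmbedding (collisionMap ω) := by
  refine (collisionMap ω).continuous_of_finiteDimensional.measurableEmbedding ?_
  refine Function.LeftInverse.injective (g := collisionMap ω) fun p => ?_
  ext1
  · exact collide_collide hω _ _
  · exact collide_collide hω _ _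

lemma fourier_mul_fourier_eq {w : Space d → ℂ} (x y : Space d) :
    𝓕 w x * 𝓕 w y = ∫ p : Space d × Space d,
      cexp (((-2 * Real.pi * (inner ℝ p.1 x + inner ℝ p.2 y) : ℝ) : ℂ) * I) * (w p.1 * w p.2) := by
  rw [Real.fourier_eq', Real.fourier_eq', ← integral_prod_mul]
  refine integral_congr_ae (ae_of_all _ fun p => ?_)
  simp only [smul_eq_mul]
  rw [mul_mul_mul_comm, ← Complex.exp_add]
  congr 2
  push_cast
  ring

/-- The product of transforms is the transform of `w ⊗ w`; substitute the collision, which is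
self-adjoint, involutive and measure preserving. -/
lemma fourier_mul_fourier_collide {w : Space d → ℂ} {ω : Space d} (hω : ‖ω‖ = 1)
    (h : ∀ᵐ p : Space d × Space d,
      w p.1 * w p.2 = w (collide ω p.1 p.2) * w (collide ω p.2 p.1)) (x y : Space d) :
    𝓕 w (collide ω x y) * 𝓕 w (collide ω y x) = 𝓕 w x * 𝓕 w y := by
  rw [fourier_mul_fourier_eq, fourier_mul_fourier_eq,
    ← (measurePreserving_collisionMap hω).integral_comp (measurableEmbedding_collisionMap hω)]
  refine integral_congr_ae ?_
  filter_upwards [h] with p hp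
  simp only [collisionMap, LinearMap.coe_mk, AddHom.coe_mk]
  rw [hp, inner_collide_add, collide_collide hω, collide_collide hω]

/-- The weight only sees `(a-b)·ω > 0`. Swapping `a` and `b` covers the opposite half, and on the
separating hyperplane the collision is the identity. -/
lemma ae_collision_invariant {F : Space d → ℂ} (hF : Measurable F) (h : collisionDefect F = 0) :
    ∀ᵐ ω : UnitSphere d ∂sphereMeasure d, ∀ᵐ p : Space d × Space d,
      F p.1 * F p.2 = F (collide (ω : Space d) p.1 p.2) * F (collide (ω : Space d) p.2 p.1) := by
  rw [collisionDefect, lintegral_eq_zero_iff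
    (measurable_defect hF).lintegral_prod_right'.lintegral_prod_right'] at h
  filter_upwards [h] with ω hω
  have hm : Measurable fun p : Space d × Space d =>
      ENNReal.ofReal (inner ℝ (p.1 - p.2) (ω : Space d)) ^ 2 *
      ‖F p.1 * F p.2 - F (collide (ω : Space d) p.1 p.2) *
        F (collide (ω : Space d) p.2 p.1)‖ₑ ^ 2 :=
    (measurable_defect hF).comp (f := fun p : Space d × Space d => ((ω, p.1), p.2)) (by fun_prop)
  have h1 : ∀ᵐ p : Space d × Space d, 0 < inner ℝ (p.1 - p.2) (ω : Space d) →
      F p.1 * F p.2 = F (collide (ω : Space d) p.1 p.2) * F (collide (ω : Space d) p.2 p.1) := by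
    have h2 := (lintegral_prod _ hm.aemeasurable (μ := volume) (ν := volume)).trans hω
    rw [Pi.zero_apply, lintegral_eq_zero_iff hm] at h2
    filter_upwards [h2] with p hp hpos
    simp only [Pi.zero_apply, mul_eq_zero, pow_eq_zero_iff, ne_eq, OfNat.ofNat_ne_zero,
      not_false_eq_true, ENNReal.ofReal_eq_zero, enorm_eq_zero] at hp
    exact sub_eq_zero.1 (hp.resolve_left hpos.not_ge)
  have h3 : ∀ᵐ p : Space d × Space d, 0 < inner ℝ (p.2 - p.1) (ω : Space d) →
      F p.2 * F p.1 = F (collide (ω : Space d) p.2 p.1) * F (collide (ω : Space d) p.1 p.2) :=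
    (Measure.measurePreserving_swap (μ := (volume : Measure (Space d)))
      (ν := (volume : Measure (Space d)))).quasiMeasurePreserving.ae h1
  filter_upwards [h1, h3] with p hp hp'
  rcases lt_trichotomy (inner ℝ (p.1 - p.2) (ω : Space d)) 0 with h4 | h4 | h4
  · rw [mul_comm, hp', mul_comm]
    rwa [← neg_sub, inner_neg_left, neg_pos]
  · have h5 : inner ℝ (p.2 - p.1) (ω : Space d) = (0 : ℝ) := by
      rw [← neg_sub, inner_neg_left, h4, neg_zero]
    simp [collide, h4, h5]
  · exact hp h4

/-- For `|p| = |q|`, the collision in direction `p - q`, normalised, carries `(m+p, m-p)` to `(m+q,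
m-q)`. -/
lemma isCollisionInvariant_of_collide {G : Space d → ℂ}
    (h : ∀ ω : Space d, ‖ω‖ = 1 → ∀ x y, G (collide ω x y) * G (collide ω y x) = G x * G y) :
    IsCollisionInvariant G := by
  intro m p q hpq
  rcases eq_or_ne p q with rfl | hne
  · rfl
  have hn : ‖p - q‖ ≠ 0 := norm_ne_zero_iff.2 (sub_ne_zero.2 hne)
  have := h (‖p - q‖⁻¹ • (p - q)) (by rw [norm_smul, norm_inv, norm_norm, inv_mul_cancel₀ hn])
    (m + p) (m - p)
  rw [← this]
  have h1 : inner ℝ p (p - q) = 2⁻¹ * ‖p - q‖ ^ 2 := by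
    rw [norm_sub_sq_real, inner_sub_right, real_inner_self_eq_norm_sq, ← hpq]; ring
  have h2 : m + p - (m - p) = (2 : ℝ) • p := by module
  have h3 : m - p - (m + p) = (-2 : ℝ) • p := by module
  congr 2
  · rw [collide, h2, real_inner_smul_left, real_inner_smul_right, h1, smul_smul,
      show 2 * (‖p - q‖⁻¹ * (2⁻¹ * ‖p - q‖ ^ 2)) * ‖p - q‖⁻¹ = 1 by field_simp]
    module
  · rw [collide, h3, real_inner_smul_left, real_inner_smul_right, h1, smul_smul,
      show -2 * (‖p - q‖⁻¹ * (2⁻¹ * ‖p - q‖ ^ 2)) * ‖p - q‖⁻¹ = -1 by field_simp]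
    module

/-- The function `F` times a Gaussian weight. -/
def gaussWeight (F : Space d → ℂ) (x : Space d) : ℂ := cexp (-(1 : ℂ) * ‖x‖ ^ 2) * F x

/-- The weight is collision invariant because `|a|² + |b|²` is conserved. The transform of the
integrable weighted function is continuous, which upgrades almost every `ω` to every `ω`. -/
lemma isCollisionInvariant_fourier_gaussWeight {F : Space d → ℂ} (hF : Measurable F)
    (hw : Integrable (gaussWeight F)) (h : collisionDefect F = 0) :
    IsCollisionInvariant (𝓕 (gaussWeight F)) := by
  apply isCollisionInvariant_of_collide
  intro ω hω x y
  have hc := continuous_fourier_of_integrable hw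
  have hae : (fun ω : UnitSphere d => 𝓕 (gaussWeight F) (collide (ω : Space d) x y) *
      𝓕 (gaussWeight F) (collide (ω : Space d) y x)) =ᵐ[sphereMeasure d]
      fun _ => 𝓕 (gaussWeight F) x * 𝓕 (gaussWeight F) y := by
    filter_upwards [ae_collision_invariant hF h] with ω hω
    have hn : ‖(ω : Space d)‖ = 1 := norm_eq_of_mem_sphere ω
    refine fourier_mul_fourier_collide hn ?_ x y
    filter_upwards [hω] with p hp
    unfold gaussWeight
    rw [mul_mul_mul_comm, hp, mul_mul_mul_comm (cexp (-1 * (‖collide _ _ _‖ : ℂ) ^ 2)),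
      ← Complex.exp_add, ← Complex.exp_add]
    congr 2
    rw [← mul_add, ← mul_add]
    congr 1
    exact_mod_cast (norm_collide_sq_add hn p.1 p.2).symm
  have := (Continuous.ae_eq_iff_eq (sphereMeasure d)
    ((hc.comp (by unfold collide; fun_prop)).mul (hc.comp (by unfold collide; fun_prop)))
    continuous_const).1 hae
  exact congrFun this ⟨ω, by simpa using hω⟩

/-! ### Gaussians: integrability, Fourier transform and defects -/

/-- The exponential of a quadratic polynomial with radial leading part. -/
def quadExp (κ : ℂ) (β : Fin d → ℂ) (c : ℂ) (x : Space d) : ℂ :=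
  cexp (κ * (‖x‖ ^ 2 : ℝ) + ∑ i, β i * x i + c)

variable {κ : ℂ} {β : Fin d → ℂ} {c : ℂ}

lemma quadExp_ne_zero (x : Space d) : quadExp κ β c x ≠ 0 := Complex.exp_ne_zero _

lemma continuous_quadExp : Continuous (quadExp κ β c) := by
  unfold quadExp; fun_prop

lemma quadExp_neg (x : Space d) : quadExp κ β c (-x) = quadExp κ (-β) c x := by
  simp [quadExp]

lemma quadExp_mul {κ₁ κ₂ : ℂ} {β₁ β₂ : Fin d → ℂ} {c₁ c₂ : ℂ} (x : Space d) :
    quadExp κ₁ β₁ c₁ x * quadExp κ₂ β₂ c₂ x = quadExp (κ₁ + κ₂) (β₁ + β₂) (c₁ + c₂) x := by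
  simp only [quadExp, ← Complex.exp_add, Pi.add_apply, add_mul, Finset.sum_add_distrib]
  congr 1
  ring

lemma norm_quadExp (x : Space d) : ‖quadExp κ β c x‖ =
    Real.exp (κ.re * ‖x‖ ^ 2 + inner ℝ (WithLp.toLp 2 fun i => (β i).re : Space d) x + c.re) := by
  rw [quadExp, Complex.norm_exp, add_re, add_re, re_mul_ofReal, re_sum, PiLp.inner_apply]
  simp [mul_comm]

lemma quadExp_measurable_comp (x : Space d) : quadExp κ β c x =
    cexp c * cexp (-(-κ) * ∑ i, ((MeasurableEquiv.toLp 2 (Fin d → ℝ)).symm x i : ℂ) ^ 2 +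
      ∑ i, β i * ((MeasurableEquiv.toLp 2 (Fin d → ℝ)).symm x i : ℂ)) := by
  rw [quadExp, ← Complex.exp_add, EuclideanSpace.norm_sq_eq]
  congr 1
  simp [add_comm]

lemma integrable_quadExp (hκ : κ.re < 0) : Integrable (quadExp κ β c) := by
  have := ((EuclideanSpace.volume_preserving_symm_measurableEquiv_toLp (Fin d)).integrable_comp_emb
    (MeasurableEquiv.measurableEmbedding _)).2
    (GaussianFourier.integrable_cexp_neg_mul_sum_add (b := -κ) (by simpa using hκ) β)
  exact (this.const_mul (cexp c)).congr
    (ae_of_all _ fun x => (quadExp_measurable_comp x).symm)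

lemma integral_quadExp (hκ : κ.re < 0) : ∫ x, quadExp κ β c x =
    cexp c * ((Real.pi / -κ) ^ (Fintype.card (Fin d) / 2 : ℂ) *
      cexp ((∑ i, β i ^ 2) / (4 * -κ))) := by
  rw [← GaussianFourier.integral_cexp_neg_mul_sum_add (b := -κ) (by simpa using hκ) β,
    ← (EuclideanSpace.volume_preserving_symm_measurableEquiv_toLp (Fin d)).integral_comp
      (MeasurableEquiv.measurableEmbedding _), ← integral_const_mul]
  exact integral_congr_ae (ae_of_all _ fun x => quadExp_measurable_comp x)

lemma re_pi_sq_div_neg (hκ : κ.re < 0) : ((Real.pi : ℂ) ^ 2 / κ).re < 0 := by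
  have h0 : κ ≠ 0 := fun h => by simp [h] at hκ
  rw [div_re, ← ofReal_pow, ofReal_re, ofReal_im, zero_mul, zero_div, add_zero]
  exact div_neg_of_neg_of_pos (mul_neg_of_pos_of_neg (by positivity) hκ) (normSq_pos.2 h0)

/-- The frequency is absorbed into the linear coefficient, `β - 2πiξ`, and the Gaussian integral is
again quadratic in `ξ`. Its nonzero prefactor enters the exponent through a logarithm. -/
lemma exists_fourier_quadExp (hκ : κ.re < 0) : ∃ (κ' : ℂ) (β' : Fin d → ℂ) (c' : ℂ),
    κ'.re < 0 ∧ 𝓕 (quadExp κ β c) = quadExp κ' β' c' := by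
  have h0 : κ ≠ 0 := fun h => by simp [h] at hκ
  have hA : ((Real.pi / -κ : ℂ)) ^ (Fintype.card (Fin d) / 2 : ℂ) ≠ 0 := by
    rw [Ne, cpow_eq_zero_iff]
    simp [h0, Real.pi_ne_zero]
  refine ⟨Real.pi ^ 2 / κ, fun i => Real.pi * I * β i / κ,
    c + Complex.log ((Real.pi / -κ : ℂ) ^ (Fintype.card (Fin d) / 2 : ℂ)) +
      (∑ i, β i ^ 2) / (4 * -κ), re_pi_sq_div_neg hκ, ?_⟩
  ext ξ
  have h1 : 𝓕 (quadExp κ β c) ξ =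
      ∫ x, quadExp κ (fun i => β i - 2 * Real.pi * I * ξ i) c x := by
    rw [Real.fourier_eq']
    refine integral_congr_ae (ae_of_all _ fun x => ?_)
    simp only [quadExp, smul_eq_mul, ← Complex.exp_add, PiLp.inner_apply]
    congr 1
    simp only [sub_mul, Finset.sum_sub_distrib]
    have : ((-2 * Real.pi * ∑ i, inner ℝ (x i) (ξ i) : ℝ) : ℂ) * I =
        -∑ i, 2 * Real.pi * I * ξ i * x i := by
      push_cast
      rw [Finset.mul_sum, Finset.sum_mul, ← Finset.sum_neg_distrib]
      refine Finset.sum_congr rfl fun i _ => ?_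
      simp
      ring
    rw [this]
    ring
  rw [h1, integral_quadExp hκ, quadExp, Complex.exp_add, Complex.exp_add _ (_ / _),
    Complex.exp_add c, Complex.exp_log hA]
  have h2 : (∑ i, (β i - 2 * Real.pi * I * ξ i) ^ 2) / (4 * -κ) =
      Real.pi ^ 2 / κ * (‖ξ‖ ^ 2 : ℝ) + ∑ i, Real.pi * I * β i / κ * ξ i +
        (∑ i, β i ^ 2) / (4 * -κ) := by
    rw [EuclideanSpace.norm_sq_eq]
    push_cast
    rw [Finset.mul_sum, Finset.sum_div, Finset.sum_div, ← Finset.sum_add_distrib,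
      ← Finset.sum_add_distrib]
    refine Finset.sum_congr rfl fun i _ => ?_
    have : ((|ξ i| : ℝ) : ℂ) ^ 2 = (ξ i : ℂ) ^ 2 := by
      rw [← ofReal_pow, sq_abs, ofReal_pow]
    simp only [Real.norm_eq_abs, this]
    field_simp
    linear_combination (-4 * Real.pi ^ 2 * (ξ i : ℂ) ^ 2) * I_sq
  rw [h2, Complex.exp_add]
  ring

lemma exists_fourierInv_quadExp (hκ : κ.re < 0) : ∃ (κ' : ℂ) (β' : Fin d → ℂ) (c' : ℂ),
    κ'.re < 0 ∧ 𝓕⁻ (quadExp κ β c) = quadExp κ' β' c' := by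
  obtain ⟨κ', β', c', h, h'⟩ := exists_fourier_quadExp (β := β) (c := c) hκ
  refine ⟨κ', -β', c', h, ?_⟩
  ext x
  rw [Real.fourierInv_eq_fourier_neg, h', quadExp_neg]

lemma norm_quadExp_sq (x : Space d) :
    ‖quadExp κ β c x‖ ^ 2 = ‖quadExp (κ + κ) (β + β) (c + c) x‖ := by
  rw [← quadExp_mul, norm_mul, sq]

lemma memLp_quadExp (hκ : κ.re < 0) : MemLp (quadExp κ β c) 2 volume := by
  rw [memLp_two_iff_integrable_sq_norm continuous_quadExp.aestronglyMeasurable]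
  simp_rw [norm_quadExp_sq]
  exact (integrable_quadExp (by rw [add_re]; linarith)).norm

/-- In the integrable product of the values at `x` and `-x` the linear terms cancel; if `Re κ ≥ 0`,
its modulus is at least a positive constant, on a space of infinite volume. -/
lemma re_neg_of_memLp_quadExp (hd : d ≠ 0) (h : MemLp (quadExp κ β c) 2 volume) : κ.re < 0 := by
  by_contra! hκ
  have h1 : MemLp (fun x : Space d => quadExp κ β c (-x)) 2 volume :=
    h.comp_measurePreserving (Measure.measurePreserving_neg volume)
  have h2 : Integrable fun x : Space d => quadExp κ β c x * quadExp κ β c (-x) :=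
    h.integrable_mul h1
  have h3 : Integrable fun _ : Space d => Real.exp (c.re + c.re) := by
    refine h2.mono aestronglyMeasurable_const (ae_of_all _ fun x => ?_)
    rw [quadExp_neg, quadExp_mul, norm_quadExp, Real.norm_of_nonneg (Real.exp_pos _).le]
    have h4 : (WithLp.toLp 2 fun i => ((β + -β) i).re : Space d) = 0 := by
      ext i; simp
    rw [h4, inner_zero_left, add_zero, add_re, add_re]
    exact Real.exp_le_exp.2 (le_add_of_nonneg_left (by positivity))
  rw [integrable_const_iff] at h3
  have : Nonempty (Fin d) := ⟨⟨0, Nat.pos_of_ne_zero hd⟩⟩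
  rcases h3 with h3 | h3
  · exact (Real.exp_pos _).ne' h3
  · have := h3.measure_univ_lt_top
    simp at this

lemma norm_gaussWeight_le (F : Space d → ℂ) (x : Space d) : ‖gaussWeight F x‖ ≤ ‖F x‖ := by
  rw [gaussWeight, norm_mul, Complex.norm_exp]
  refine mul_le_of_le_one_left (norm_nonneg _) (Real.exp_le_one_iff.2 ?_)
  rw [← ofReal_pow, re_mul_ofReal]
  simp

lemma gaussWeight_eq (F : Space d → ℂ) (x : Space d) :
    gaussWeight F x = quadExp (-1) 0 0 x * F x := by
  simp [gaussWeight, quadExp]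

lemma fourier_injective_ae {v w : Space d → ℂ} (hv : Integrable v) (hv2 : MemLp v 2)
    (hw : Integrable w) (hw2 : MemLp w 2) (h : 𝓕 v = 𝓕 w) : v =ᵐ[volume] w := by
  have h1 : (𝓕 (hv2.toLp v) : L2 d) = 𝓕 (hw2.toLp w) := by
    refine Lp.ext ((coeFn_fourier_toLp hv hv2).trans ?_)
    rw [h]
    exact (coeFn_fourier_toLp hw hw2).symm
  have h2 : hv2.toLp v = hw2.toLp w := (Lp.fourierTransformₗᵢ (Space d) ℂ).injective h1
  exact (MemLp.toLp_eq_toLp_iff hv2 hw2).1 h2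

/-- The transform of the weighted function solves the functional equation and lies in `L²`, so it is
a Gaussian, and so is its inverse transform. Removing the weight adds `1` to the quadratic
coefficient; that its real part stays negative follows afresh from `F ∈ L²`. -/
theorem exists_quadExp_of_collisionDefect_eq_zero (hd : 2 ≤ d) {F : Space d → ℂ}
    (hF : Measurable F) (hF2 : MemLp F 2 volume) (hne : ¬ F =ᵐ[volume] 0)
    (h : collisionDefect F = 0) :
    ∃ (κ : ℂ) (β : Fin d → ℂ) (c : ℂ), κ.re < 0 ∧ F =ᵐ[volume] quadExp κ β c := by
  have hg : MemLp (quadExp (-1) (0 : Fin d → ℂ) 0) 2 volume := memLp_quadExp (by simp)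
  have hw1 : Integrable (gaussWeight F) :=
    (hg.integrable_mul hF2).congr (ae_of_all _ fun x => (gaussWeight_eq F x).symm)
  have hw2 : MemLp (gaussWeight F) 2 volume :=
    hF2.mono hw1.1 (ae_of_all _ (norm_gaussWeight_le F))
  have hx₀ : ∃ x₀, 𝓕 (gaussWeight F) x₀ ≠ 0 := by
    by_contra! h0
    apply hne
    have h1 : 𝓕 (gaussWeight F) = 𝓕 (0 : Space d → ℂ) := by
      ext x
      rw [h0, Real.fourier_eq']
      simp
    filter_upwards [fourier_injective_ae hw1 hw2 (integrable_zero _ _ _) MemLp.zero h1] with x hx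
    rw [gaussWeight_eq] at hx
    exact (mul_eq_zero.1 hx).resolve_left (quadExp_ne_zero x)
  obtain ⟨x₀, hx₀⟩ := hx₀
  obtain ⟨κ, β, c, hG⟩ := IsCollisionInvariant.exists_exp hd
    (continuous_fourier_of_integrable hw1) (isCollisionInvariant_fourier_gaussWeight hF hw1 h) hx₀
  have hG' : 𝓕 (gaussWeight F) = quadExp κ β c := funext hG
  have hκ : κ.re < 0 := by
    refine re_neg_of_memLp_quadExp (β := β) (c := c) (by omega : d ≠ 0) ?_
    rw [← hG']
    exact (memLp_congr_ae (coeFn_fourier_toLp hw1 hw2)).1 (Lp.memLp _)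
  obtain ⟨κ₁, β₁, c₁, hκ₁, hv⟩ := exists_fourierInv_quadExp (β := β) (c := c) hκ
  obtain ⟨κ₂, β₂, c₂, hκ₂, hv2⟩ := exists_fourier_quadExp (β := β) (c := c) hκ
  have h1 : 𝓕 (quadExp κ₁ β₁ c₁) = 𝓕 (gaussWeight F) := by
    rw [hG', ← hv]
    refine continuous_quadExp.fourier_fourierInv_eq (integrable_quadExp hκ) ?_
    rw [hv2]
    exact integrable_quadExp hκ₂
  have h2 := fourier_injective_ae (integrable_quadExp hκ₁) (memLp_quadExp hκ₁) hw1 hw2 h1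
  have h3 : F =ᵐ[volume] quadExp (κ₁ + 1) β₁ c₁ := by
    filter_upwards [h2] with x hx
    have h4 : quadExp 1 0 0 x * quadExp (-1) 0 0 x = 1 := by
      rw [quadExp_mul]; simp [quadExp]
    rw [show quadExp (κ₁ + 1) β₁ c₁ x = quadExp κ₁ β₁ c₁ x * quadExp 1 0 0 x by
      rw [quadExp_mul, add_zero, add_zero], hx, gaussWeight_eq]
    linear_combination (-F x) * h4
  exact ⟨_, _, _, re_neg_of_memLp_quadExp (by omega) ((memLp_congr_ae h3).1 hF2), h3⟩

lemma lintegral_enorm_sq_quadExp_lt_top (hκ : κ.re < 0) :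
    ∫⁻ x, ‖quadExp κ β c x‖ₑ ^ 2 < ∞ := by
  have := (memLp_quadExp (β := β) (c := c) hκ).2
  rw [← eLpNorm_two_sq]
  exact ENNReal.pow_lt_top this

lemma lintegral_norm_sq_mul_enorm_sq_quadExp_lt_top (hκ : κ.re < 0) :
    ∫⁻ x, ‖x‖ₑ ^ 2 * ‖quadExp κ β c x‖ₑ ^ 2 < ∞ := by
  -- With this choice `|x|² ≤ ε⁻¹ exp(ε|x|²)`, while `2κ + ε` still has negative real part `Re κ`.
  set ε : ℝ := -κ.re with hε
  have hε0 : 0 < ε := by simpa [hε] using hκ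
  have hi : Integrable (fun x => ε⁻¹ * ‖quadExp (κ + κ + ε) (β + β) (c + c) x‖) :=
    (integrable_quadExp (by simp [hε]; linarith)).norm.const_mul _
  refine lt_of_le_of_lt (lintegral_mono fun x => ?_) hi.2
  rw [← ofReal_norm, ← ofReal_norm, ← ofReal_norm, ← ENNReal.ofReal_pow (norm_nonneg _),
    ← ENNReal.ofReal_pow (norm_nonneg _), ← ENNReal.ofReal_mul (by positivity)]
  refine ENNReal.ofReal_le_ofReal ?_
  rw [norm_quadExp_sq, norm_mul, norm_norm, Real.norm_of_nonneg (by positivity)]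
  have h1 : ‖quadExp (κ + κ + ε) (β + β) (c + c) x‖ =
      Real.exp (ε * ‖x‖ ^ 2) * ‖quadExp (κ + κ) (β + β) (c + c) x‖ := by
    rw [norm_quadExp, norm_quadExp, ← Real.exp_add, add_re (κ + κ), ofReal_re]
    congr 1
    ring
  rw [h1, ← mul_assoc]
  refine mul_le_mul_of_nonneg_right ?_ (norm_nonneg _)
  rw [le_inv_mul_iff₀ hε0]
  linarith [Real.add_one_le_exp (ε * ‖x‖ ^ 2)]

/-- Collisions conserve `|a|² + |b|²` and `a + b`, the only quantities entering the product. -/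
lemma collisionDefect_quadExp : collisionDefect (quadExp κ β c) = 0 := by
  rw [collisionDefect]
  refine (lintegral_congr fun ω => ?_).trans lintegral_zero
  refine (lintegral_congr fun x => ?_).trans lintegral_zero
  refine (lintegral_congr fun y => ?_).trans lintegral_zero
  have hω : ‖(ω : Space d)‖ = 1 := norm_eq_of_mem_sphere ω
  have h1 : quadExp κ β c x * quadExp κ β c y = quadExp κ β c (collide (ω : Space d) x y) *
      quadExp κ β c (collide (ω : Space d) y x) := by
    have h2 : ((‖collide (ω : Space d) x y‖ ^ 2 : ℝ) : ℂ) + (‖collide (ω : Space d) y x‖ ^ 2 : ℝ) =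
        (‖x‖ ^ 2 : ℝ) + (‖y‖ ^ 2 : ℝ) := by
      exact_mod_cast norm_collide_sq_add hω x y
    have h3 : ∑ i, β i * (collide (ω : Space d) x y i : ℂ) +
        ∑ i, β i * (collide (ω : Space d) y x i : ℂ) = ∑ i, β i * x i + ∑ i, β i * y i := by
      rw [← Finset.sum_add_distrib, ← Finset.sum_add_distrib]
      refine Finset.sum_congr rfl fun i _ => ?_
      have h4 : collide (ω : Space d) x y + collide (ω : Space d) y x = x + y := by
        simp only [collide, inner_sub_left]; module
      have h5 : ((collide (ω : Space d) x y i : ℝ) : ℂ) + (collide (ω : Space d) y x i : ℝ) =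
          (x i : ℝ) + (y i : ℝ) := by
        exact_mod_cast congrArg (fun z : Space d => z i) h4
      linear_combination β i * h5
    simp only [quadExp, ← Complex.exp_add]
    congr 1
    linear_combination (-κ) * h2 - h3
  rw [h1, sub_self]
  simp

lemma firstMoment_congr_ae {F G : Space d → ℂ} (h : F =ᵐ[volume] G) :
    firstMoment F = firstMoment G := by
  refine integral_congr_ae ?_
  filter_upwards [h] with x hx
  rw [hx]

lemma firstMoment_quadExp_of_re_eq_zero (hβ : ∀ i, (β i).re = 0) :
    firstMoment (quadExp κ β c) = 0 := by
  have h0 : (WithLp.toLp 2 fun i => (β i).re : Space d) = 0 := by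
    ext i; simp [hβ]
  have h1 : ∀ x, ‖quadExp κ β c (-x)‖ = ‖quadExp κ β c x‖ := fun x => by
    rw [norm_quadExp, norm_quadExp, h0, inner_zero_left, inner_zero_left, norm_neg]
  have h2 : firstMoment (quadExp κ β c) = -firstMoment (quadExp κ β c) := by
    rw [firstMoment, ← integral_neg, ← integral_neg_eq_self]
    simp_rw [h1, smul_neg]
  have h3 : (2 : ℝ) • firstMoment (quadExp κ β c) = 0 := by
    rw [two_smul]
    nth_rewrite 2 [h2]
    exact add_neg_cancel _
  simpa using h3

/-- Pair the moment with `v = Re β` and symmetrise in `x`. The integrand becomes a positive factor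
times `2 sinh(2 v·x) (v·x) ≥ 0`, with integral zero; by continuity it vanishes everywhere, and at `x
= v` this gives `v = 0`. -/
lemma re_eq_zero_of_firstMoment_quadExp (hκ : κ.re < 0) (h : firstMoment (quadExp κ β c) = 0)
    (i : Fin d) : (β i).re = 0 := by
  set v : Space d := WithLp.toLp 2 fun i => (β i).re with hv
  have hcont : Continuous (quadExp κ β c) := continuous_quadExp
  have hint : Integrable fun x : Space d => ‖quadExp κ β c x‖ ^ 2 • x :=
    (integrable_moments continuous_quadExp.measurable (lintegral_enorm_sq_quadExp_lt_top hκ)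
      (lintegral_norm_sq_mul_enorm_sq_quadExp_lt_top hκ)).2.1
  set φ : Space d → ℝ := fun x => ‖quadExp κ β c x‖ ^ 2 * inner ℝ v x with hφ
  have hφc : Continuous φ := by fun_prop
  have hφi : Integrable φ := by
    refine (hint.const_inner (𝕜 := ℝ) v).congr (ae_of_all _ fun x => ?_)
    simp only [hφ, real_inner_smul_right]
  have hφ0 : ∫ x, φ x = 0 := by
    have := integral_inner (𝕜 := ℝ) hint v
    simp_rw [real_inner_smul_right] at this
    rw [hφ, this, show (∫ x : Space d, ‖quadExp κ β c x‖ ^ 2 • x) = 0 from h, inner_zero_right]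
  have hφi' : Integrable fun x => φ (-x) := hφi.comp_neg
  have hsum : ∫ x, (φ x + φ (-x)) = 0 := by
    rw [integral_add hφi hφi', integral_neg_eq_self, hφ0, add_zero]
  have hval : ∀ x, φ x + φ (-x) = Real.exp (2 * κ.re * ‖x‖ ^ 2 + 2 * c.re) *
      ((Real.exp (2 * inner ℝ v x) - Real.exp (-(2 * inner ℝ v x))) * inner ℝ v x) := by
    intro x
    simp only [hφ, norm_quadExp, ← hv, norm_neg, inner_neg_right, ← Real.exp_nat_mul]
    rw [sub_mul, mul_sub, ← mul_assoc, ← mul_assoc, ← Real.exp_add, ← Real.exp_add, mul_neg,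
      ← sub_eq_add_neg]
    congr 3
    · push_cast; ring
    · push_cast; ring
  have hnn : 0 ≤ fun x => φ x + φ (-x) := by
    intro x
    simp only [Pi.zero_apply, hval]
    refine mul_nonneg (Real.exp_pos _).le ?_
    rcases le_total 0 (inner ℝ v x) with h1 | h1
    · exact mul_nonneg (sub_nonneg.2 (Real.exp_le_exp.2 (by linarith))) h1
    · exact mul_nonneg_of_nonpos_of_nonpos (sub_nonpos.2 (Real.exp_le_exp.2 (by linarith))) h1
  have hzero := (integral_eq_zero_iff_of_nonneg hnn (hφi.add hφi')).1 hsum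
  have hall := (Continuous.ae_eq_iff_eq volume (hφc.add (hφc.comp continuous_neg))
    continuous_zero).1 hzero
  have hvv := congrFun hall v
  simp only [Pi.zero_apply] at hvv
  have hvv' := (hval v).symm.trans hvv
  have hv0 : inner ℝ v v = (0 : ℝ) := by
    rcases mul_eq_zero.1 hvv' with h1 | h1
    · exact ((Real.exp_pos _).ne' h1).elim
    rcases mul_eq_zero.1 h1 with h1 | h1
    · have := Real.exp_injective (sub_eq_zero.1 h1)
      linarith
    · exact h1
  have := congrArg (fun z : Space d => z i) (inner_self_eq_zero.1 hv0)
  simpa [hv] using this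

lemma spaceTimeIntegral_congr_ae {F G : Space d → ℂ} (h : F =ᵐ[volume] G) :
    spaceTimeIntegral F = spaceTimeIntegral G := by
  unfold spaceTimeIntegral
  refine lintegral_congr fun t => lintegral_congr fun ξ => ?_
  congr 3
  refine integral_congr_ae ?_
  have h1 : ∀ᵐ η : Space d, F (η - ξ) = G (η - ξ) :=
    (measurePreserving_sub_right ξ).quasiMeasurePreserving.ae h
  filter_upwards [h, h1] with η h2 h3
  rw [h2, h3]

/-! ### The inequality and its equality cases on the Fourier side -/

/-- The mass of `|x|² |F|²` times the mass of `|F|²`. -/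
def momentProduct (F : Space d → ℂ) : ℝ≥0∞ :=
  (∫⁻ x, ‖x‖ₑ ^ 2 * ‖F x‖ₑ ^ 2) * ∫⁻ x, ‖F x‖ₑ ^ 2

lemma momentProduct_congr_ae {F G : Space d → ℂ} (h : F =ᵐ[volume] G) :
    momentProduct F = momentProduct G := by
  unfold momentProduct
  congr 1
  · refine lintegral_congr_ae ?_
    filter_upwards [h] with x hx
    rw [hx]
  · refine lintegral_congr_ae ?_
    filter_upwards [h] with x hx
    rw [hx]

/-- The best constant in the estimate, for data given by their Fourier transforms. -/
def momentConstant (d : ℕ) : ℝ≥0∞ :=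
  ENNReal.ofReal ((2 * Real.pi) ^ (4 - d : ℝ) / (4 * Real.pi)) *
    volume (Metric.ball (0 : Space d) 1)

lemma spaceTimeIntegral_le (hd : d ≠ 0) {F : Space d → ℂ} (hF : Measurable F)
    (hF0 : ∫⁻ x, ‖F x‖ₑ ^ 2 < ∞) (hF2 : ∫⁻ x, ‖x‖ₑ ^ 2 * ‖F x‖ₑ ^ 2 < ∞) :
    spaceTimeIntegral F ≤ momentConstant d * momentProduct F := by
  rw [momentConstant, momentProduct, mul_assoc, ← spaceTimeIntegral_add_defects hd hF hF0 hF2]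
  exact le_self_add

lemma momentConstant_ne_top : momentConstant d ≠ ∞ :=
  ENNReal.mul_ne_top ENNReal.ofReal_ne_top measure_ball_lt_top.ne

lemma momentConstant_ne_zero : momentConstant d ≠ 0 := by
  refine mul_ne_zero ?_ (Metric.measure_ball_pos _ _ one_pos).ne'
  rw [ENNReal.ofReal_ne_zero_iff]
  positivity

/-- The finite space-time integral can be cancelled, and a sum of two nonnegative defects with
positive coefficients vanishes only if both do. -/
lemma spaceTimeIntegral_eq_iff (hd : d ≠ 0) {F : Space d → ℂ} (hF : Measurable F)
    (hF0 : ∫⁻ x, ‖F x‖ₑ ^ 2 < ∞) (hF2 : ∫⁻ x, ‖x‖ₑ ^ 2 * ‖F x‖ₑ ^ 2 < ∞) :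
    spaceTimeIntegral F = momentConstant d * momentProduct F ↔
      collisionDefect F = 0 ∧ firstMoment F = 0 := by
  have hle := spaceTimeIntegral_le hd hF hF0 hF2
  have hfin : momentConstant d * momentProduct F ≠ ∞ :=
    ENNReal.mul_ne_top momentConstant_ne_top (ENNReal.mul_ne_top hF2.ne hF0.ne)
  have hs : spaceTimeIntegral F ≠ ∞ := (hle.trans_lt hfin.lt_top).ne
  have hc := momentConstant_ne_zero (d := d)
  rw [momentConstant] at hc
  rw [momentConstant, momentProduct, mul_assoc, ← spaceTimeIntegral_add_defects hd hF hF0 hF2]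
  constructor
  · intro h
    have h1 := (ENNReal.add_right_inj hs).1 ((add_zero _).trans h)
    have h2 := (mul_eq_zero.1 h1.symm).resolve_left (left_ne_zero_of_mul hc)
    rw [add_eq_zero] at h2
    refine ⟨(mul_eq_zero.1 h2.1).resolve_left (by simp), ?_⟩
    simpa using (mul_eq_zero.1 h2.2).resolve_left (right_ne_zero_of_mul hc)
  · rintro ⟨h1, h2⟩
    simp [h1, h2]

theorem spaceTimeIntegral_eq_iff_exists_quadExp (hd : 2 ≤ d) {F : Space d → ℂ} (hF : Measurable F)
    (hne : ¬ F =ᵐ[volume] 0)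
    (hF0 : ∫⁻ x, ‖F x‖ₑ ^ 2 < ∞) (hF2 : ∫⁻ x, ‖x‖ₑ ^ 2 * ‖F x‖ₑ ^ 2 < ∞) :
    spaceTimeIntegral F = momentConstant d * momentProduct F ↔
      ∃ (κ : ℂ) (β : Fin d → ℂ) (c : ℂ), κ.re < 0 ∧ (∀ i, (β i).re = 0) ∧
        F =ᵐ[volume] quadExp κ β c := by
  have hd0 : d ≠ 0 := by omega
  constructor
  · intro h
    obtain ⟨h1, h2⟩ := (spaceTimeIntegral_eq_iff hd0 hF hF0 hF2).1 h
    obtain ⟨κ, β, c, hκ, hG⟩ := exists_quadExp_of_collisionDefect_eq_zero hd hF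
      (memLp_two_of_lintegral hF.aestronglyMeasurable hF0) hne h1
    rw [firstMoment_congr_ae hG] at h2
    exact ⟨κ, β, c, hκ, re_eq_zero_of_firstMoment_quadExp hκ h2, hG⟩
  · rintro ⟨κ, β, c, hκ, hβ, hG⟩
    rw [spaceTimeIntegral_congr_ae hG, momentProduct_congr_ae hG]
    exact (spaceTimeIntegral_eq_iff hd0 continuous_quadExp.measurable
      (lintegral_enorm_sq_quadExp_lt_top hκ)
      (lintegral_norm_sq_mul_enorm_sq_quadExp_lt_top hκ)).2
      ⟨collisionDefect_quadExp, firstMoment_quadExp_of_re_eq_zero hβ⟩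

/-! ### Return to the angular normalisation, extremisers and optimality -/

lemma quadExp_smul (r : ℝ) (x : Space d) :
    quadExp κ β c (r • x) = quadExp (r ^ 2 * κ) (fun i => r * β i) c x := by
  unfold quadExp
  congr 3
  · rw [norm_smul, mul_pow, Real.norm_eq_abs, sq_abs]
    push_cast
    ring
  · refine Finset.sum_congr rfl fun i _ => ?_
    simp
    ring

lemma isRadialModulusGaussian_iff {g : Space d → ℂ} : IsRadialModulusGaussian g ↔
    ∃ (κ : ℂ) (β : Fin d → ℂ) (c : ℂ), κ.re < 0 ∧ (∀ i, (β i).re = 0) ∧ g = quadExp κ β c := by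
  constructor
  · rintro ⟨a, c, b, ha, rfl⟩
    refine ⟨a, fun i => I * b i, c, ha, fun i => by simp, ?_⟩
    ext x
    unfold quadExp
    congr 3
    rw [PiLp.inner_apply]
    push_cast
    rw [Finset.mul_sum]
    refine Finset.sum_congr rfl fun i _ => ?_
    simp
    ring
  · rintro ⟨κ, β, c, hκ, hβ, rfl⟩
    refine ⟨κ, c, WithLp.toLp 2 fun i => (β i).im, hκ, ?_⟩
    ext x
    unfold quadExp
    congr 3
    rw [PiLp.inner_apply]
    push_cast
    rw [Finset.mul_sum]
    refine Finset.sum_congr rfl fun i _ => ?_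
    have : β i = I * (β i).im := by
      apply Complex.ext <;> simp [hβ]
    rw [this]
    simp
    ring

lemma quasiMeasurePreserving_smul_space {r : ℝ} (hr : r ≠ 0) :
    Measure.QuasiMeasurePreserving (fun x : Space d => r • x) := by
  refine ⟨measurable_const_smul r, ?_⟩
  rw [Measure.map_addHaar_smul volume hr]
  exact Measure.smul_absolutelyContinuous

lemma exists_angularFourier_eq_gaussian_iff (u₀ : L2 d) :
    (∃ g : Space d → ℂ, IsRadialModulusGaussian g ∧ angularFourier u₀ =ᵐ[volume] g) ↔
      ∃ (κ : ℂ) (β : Fin d → ℂ) (c : ℂ), κ.re < 0 ∧ (∀ i, (β i).re = 0) ∧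
        ((𝓕 u₀ : L2 d) : Space d → ℂ) =ᵐ[volume] quadExp κ β c := by
  have hπ : (2 * Real.pi) ≠ 0 := by positivity
  constructor
  · rintro ⟨g, hg, hug⟩
    obtain ⟨κ, β, c, hκ, hβ, rfl⟩ := isRadialModulusGaussian_iff.1 hg
    refine ⟨((2 * Real.pi : ℝ) : ℂ) ^ 2 * κ, fun i => ((2 * Real.pi : ℝ) : ℂ) * β i, c,
      ?_, ?_, ?_⟩
    rotate_left 2
    · filter_upwards [(quasiMeasurePreserving_smul_space hπ).ae hug] with x hx
      rw [angularFourier, smul_smul, inv_mul_cancel₀ hπ, one_smul] at hx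
      rw [hx, quadExp_smul]
    · rw [← ofReal_pow, re_ofReal_mul]
      exact mul_neg_of_pos_of_neg (by positivity) hκ
    · intro i
      rw [re_ofReal_mul, hβ, mul_zero]
  · rintro ⟨κ, β, c, hκ, hβ, h⟩
    refine ⟨_, isRadialModulusGaussian_iff.2 ⟨(((2 * Real.pi)⁻¹ : ℝ) : ℂ) ^ 2 * κ,
      fun i => (((2 * Real.pi)⁻¹ : ℝ) : ℂ) * β i, c, ?_, ?_, rfl⟩, ?_⟩
    rotate_left 2
    · filter_upwards [(quasiMeasurePreserving_smul_space (inv_ne_zero hπ)).ae h] with x hx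
      rw [angularFourier, hx, quadExp_smul]
    · rw [← ofReal_pow, re_ofReal_mul]
      exact mul_neg_of_pos_of_neg (by positivity) hκ
    · intro i
      rw [re_ofReal_mul, hβ, mul_zero]

lemma spaceTimeNormSq_eq_spaceTimeIntegral {u₀ : L2 d} {u : ℝ → L2 d}
    (h : IsSchrodingerSolution u₀ u) :
    spaceTimeNormSq ((4 - d : ℝ) / 4) u = spaceTimeIntegral (𝓕 u₀ : L2 d) := by
  rw [spaceTimeNormSq_eq h, spaceTimeIntegral, mul_div_cancel₀ _ (by norm_num : (4 : ℝ) ≠ 0)]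

lemma norms_eq_momentProduct (u₀ : L2 d) : homSobolevNorm 1 u₀ ^ 2 * ‖u₀‖ₑ ^ 2 =
    ENNReal.ofReal ((2 * Real.pi) ^ 2) * momentProduct (𝓕 u₀ : L2 d) := by
  have h : ‖u₀‖ₑ = ‖(𝓕 u₀ : L2 d)‖ₑ :=
    ((Lp.fourierTransformₗᵢ (Space d) ℂ).enorm_map u₀).symm
  rw [homSobolevNorm_one_sq, h, enorm_L2_sq, momentProduct, mul_assoc]

lemma momentConstant_eq (hd : d ≠ 0) :
    momentConstant d = ENNReal.ofReal (sharpConstant d) * ENNReal.ofReal ((2 * Real.pi) ^ 2) :=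
  ofReal_mul_volume_ball hd

lemma sharpConstant_mul_norms (hd : d ≠ 0) (u₀ : L2 d) :
    ENNReal.ofReal (sharpConstant d) * homSobolevNorm 1 u₀ ^ 2 * ‖u₀‖ₑ ^ 2 =
      momentConstant d * momentProduct (𝓕 u₀ : L2 d) := by
  rw [mul_assoc, norms_eq_momentProduct, momentConstant_eq hd, mul_assoc]

lemma estimateHolds_sharpConstant (hd : d ≠ 0) : EstimateHolds d (sharpConstant d) := by
  intro u₀ u hu₀ hu
  rw [spaceTimeNormSq_eq_spaceTimeIntegral hu, sharpConstant_mul_norms hd]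
  exact spaceTimeIntegral_le hd (Lp.stronglyMeasurable _).measurable (lintegral_L2_lt_top _)
    ((memH1_iff u₀).1 hu₀)

lemma eq_zero_of_fourier_ae_eq_zero {u₀ : L2 d}
    (h : ((𝓕 u₀ : L2 d) : Space d → ℂ) =ᵐ[volume] 0) : u₀ = 0 := by
  have h1 : (𝓕 u₀ : L2 d) = 0 := Lp.ext (h.trans (Lp.coeFn_zero _ _ _).symm)
  exact (Lp.fourierTransformₗᵢ (Space d) ℂ).map_eq_zero_iff.1 h1

lemma memH1_of_fourier_ae_eq_quadExp {u₀ : L2 d} (hκ : κ.re < 0)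
    (h : ((𝓕 u₀ : L2 d) : Space d → ℂ) =ᵐ[volume] quadExp κ β c) : MemH1 u₀ := by
  rw [memH1_iff]
  refine lt_of_le_of_lt (le_of_eq (lintegral_congr_ae ?_))
    (lintegral_norm_sq_mul_enorm_sq_quadExp_lt_top (β := β) (c := c) hκ)
  filter_upwards [h] with x hx
  rw [hx]

lemma not_quadExp_ae_eq_zero : ¬ quadExp κ β c =ᵐ[volume] 0 := by
  intro h
  obtain ⟨x, hx⟩ := h.exists
  exact quadExp_ne_zero x hx

theorem isExtremiser_iff (hd : 2 ≤ d) (u₀ : L2 d) : IsExtremiser (sharpConstant d) u₀ ↔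
    ∃ (κ : ℂ) (β : Fin d → ℂ) (c : ℂ), κ.re < 0 ∧ (∀ i, (β i).re = 0) ∧
      ((𝓕 u₀ : L2 d) : Space d → ℂ) =ᵐ[volume] quadExp κ β c := by
  have hm : Measurable ((𝓕 u₀ : L2 d) : Space d → ℂ) := (Lp.stronglyMeasurable _).measurable
  constructor
  · rintro ⟨h0, h1, u, hu, heq⟩
    rw [spaceTimeNormSq_eq_spaceTimeIntegral hu, sharpConstant_mul_norms (by omega)] at heq
    exact (spaceTimeIntegral_eq_iff_exists_quadExp hd hm
      (fun h => h0 (eq_zero_of_fourier_ae_eq_zero h)) (lintegral_L2_lt_top _)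
      ((memH1_iff u₀).1 h1)).1 heq
  · intro h
    obtain ⟨κ, β, c, hκ, hβ, hG⟩ := h
    have hne : ¬ ((𝓕 u₀ : L2 d) : Space d → ℂ) =ᵐ[volume] 0 :=
      fun h => not_quadExp_ae_eq_zero (hG.symm.trans h)
    have h1 := memH1_of_fourier_ae_eq_quadExp hκ hG
    refine ⟨?_, h1, propagator u₀, isSchrodingerSolution_propagator u₀, ?_⟩
    · rintro rfl
      apply hne
      rw [show (𝓕 (0 : L2 d) : L2 d) = 0 from (Lp.fourierTransformₗᵢ (Space d) ℂ).map_zero]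
      exact Lp.coeFn_zero _ _ _
    · rw [spaceTimeNormSq_eq_spaceTimeIntegral (isSchrodingerSolution_propagator u₀),
        sharpConstant_mul_norms (by omega)]
      exact (spaceTimeIntegral_eq_iff_exists_quadExp hd hm hne (lintegral_L2_lt_top _)
        ((memH1_iff u₀).1 h1)).2 ⟨κ, β, c, hκ, hβ, hG⟩

lemma exists_isExtremiser (hd : 2 ≤ d) : ∃ u₀ : L2 d, IsExtremiser (sharpConstant d) u₀ := by
  have hg : MemLp (quadExp (-1) (0 : Fin d → ℂ) 0) 2 volume := memLp_quadExp (by simp)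
  refine ⟨(Lp.fourierTransformₗᵢ (Space d) ℂ).symm (hg.toLp _), ?_⟩
  refine (isExtremiser_iff hd _).2 ⟨-1, 0, 0, by simp, by simp, ?_⟩
  have h : (𝓕 ((Lp.fourierTransformₗᵢ (Space d) ℂ).symm (hg.toLp _)) : L2 d) = hg.toLp _ :=
    (Lp.fourierTransformₗᵢ (Space d) ℂ).apply_symm_apply _
  rw [h]
  exact hg.coeFn_toLp

lemma sharpConstant_pos : 0 < sharpConstant d := by
  unfold sharpConstant
  have := Real.Gamma_pos_of_pos (show (0 : ℝ) < (d + 2) / 2 by positivity)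
  positivity

lemma sharpConstant_le_of_estimateHolds (hd : 2 ≤ d) {C : ℝ} (hC : EstimateHolds d C) :
    sharpConstant d ≤ C := by
  obtain ⟨u₀, h0, h1, u, hu, heq⟩ := exists_isExtremiser hd
  have hle := hC u₀ u h1 hu
  rw [heq, mul_assoc, mul_assoc, norms_eq_momentProduct] at hle
  have hm : Measurable ((𝓕 u₀ : L2 d) : Space d → ℂ) := (Lp.stronglyMeasurable _).measurable
  have hne : ¬ ((𝓕 u₀ : L2 d) : Space d → ℂ) =ᵐ[volume] 0 :=
    fun h => h0 (eq_zero_of_fourier_ae_eq_zero h)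
  have hfin : ENNReal.ofReal ((2 * Real.pi) ^ 2) * momentProduct (𝓕 u₀ : L2 d) ≠ ∞ :=
    ENNReal.mul_ne_top ENNReal.ofReal_ne_top
      (ENNReal.mul_ne_top ((memH1_iff u₀).1 h1).ne (lintegral_L2_lt_top _).ne)
  have hpos : ENNReal.ofReal ((2 * Real.pi) ^ 2) * momentProduct (𝓕 u₀ : L2 d) ≠ 0 := by
    refine mul_ne_zero (ENNReal.ofReal_ne_zero_iff.2 (by positivity)) (mul_ne_zero ?_ ?_)
    · rw [Ne, lintegral_eq_zero_iff (by fun_prop)]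
      intro h
      have : Nonempty (Fin d) := ⟨⟨0, by omega⟩⟩
      apply hne
      filter_upwards [h, Measure.ae_ne volume (0 : Space d)] with x hx hx0
      simpa [hx0] using hx
    · rw [Ne, lintegral_eq_zero_iff (by fun_prop)]
      intro h
      apply hne
      filter_upwards [h] with x hx
      simpa using hx
  -- For an extremiser the product of norms is finite and nonzero, so it cancels. A negative `C` is
  -- truncated to `0` by `ENNReal.ofReal`, which the positivity of the sharp constant excludes.
  have := (ENNReal.mul_le_mul_iff_left hpos hfin).1 hle
  rcases ENNReal.ofReal_le_ofReal_iff'.1 this with h | h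
  · exact h
  · exact absurd sharpConstant_pos h.not_gt

end OzawaTsutsumi

end

theorem corollary1p2 (d : ℕ) (hd : 2 ≤ d) :
    -- the estimate holds with this constant, and with no smaller one
    IsLeast {C : ℝ | OzawaTsutsumi.EstimateHolds d C} (OzawaTsutsumi.sharpConstant d) ∧
    -- the extremisers are exactly the data whose Fourier transform is such a gaussian
    ∀ u₀ : OzawaTsutsumi.L2 d,
      OzawaTsutsumi.IsExtremiser (OzawaTsutsumi.sharpConstant d) u₀ ↔
        ∃ g : OzawaTsutsumi.Space d → ℂ, OzawaTsutsumi.IsRadialModulusGaussian g ∧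
          OzawaTsutsumi.angularFourier u₀ =ᵐ[MeasureTheory.volume] g := by
  refine ⟨⟨OzawaTsutsumi.estimateHolds_sharpConstant (by omega), fun C hC =>
    OzawaTsutsumi.sharpConstant_le_of_estimateHolds hd hC⟩, fun u₀ => ?_⟩
  rw [OzawaTsutsumi.isExtremiser_iff hd, OzawaTsutsumi.exists_angularFourier_eq_gaussian_iff]
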